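/- **Theorem (Lagrange-type bases).** Let $d\ge 2$, $0\le k\le d$, $r\ge 1$. Let $\mathcal T_h$ be a finite mesh of nondegenerate $d$-simplices in $\mathbb R^d$, conforming in the sense that two simplices intersect exactly in the (possibly empty) sub-simplex spanned by their common vertices $\texttt v_i$, and let $\Omega$ be the union of its simplices. Let $\Delta_\ell(\mathcal T_h)$ be the set of $\ell$-dimensional sub-simplices; a sub-simplex is identified with its set of vertices. For $T\in\mathcal T_h$ let $\lambda_i$ be the barycentric coordinates on $T$, where $\lambda_i:=0$ on $T$ if $\texttt v_i\notin T$. For $g\subseteq T$ let $\nabla_g\lambda_i$ be the orthogonal projection of $\nabla\lambda_i$ onto the tangent space $\mathscr T^g$ of $g$. For a vector $u$ let $\mathrm d_\flat u=\langle u,\cdot\rangle$, and let $\langle\cdot,\cdot\rangle$ also be the standard inner product on $\operatorname{Alt}^k=\operatorname{Alt}^k(\mathbb R^d)$. Let $\Sigma(m,s)$ be the set of increasing maps $\{1,\dots,m\}\to\{1,\dots,s\}$. Fix, independently of the simplices $T$ containing them, an orthonormal basis $t^e_1,\dots,t^e_s$ of $\mathscr T^e$ for every $e\in\Delta_s(\mathcal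 T_h)$, and an ordering $[f\setminus e]=(m_1,\dots,m_{\ell-s})$ of the vertices of $f$ not in $e$ for every pair $e\subseteq f$, $f\in\Delta_\ell(\mathcal T_h)$. Let $I$ be the set of triples $(e,f,\sigma)$ with $$e\in\Delta_s(\mathcal T_h),\quad f\in\Delta_\ell(\mathcal T_h),\quad e\subseteq f,\quad 0\le s\le d,\quad \max\{s,k\}\le\ell\le\min\{k+s,d\},\quad \sigma\in\Sigma(s-(\ell-k),s),$$ and for $(e,f,\sigma)\in I$ put $\mathrm d_\flat t^e_\sigma=\mathrm d_\flat t^e_{\sigma(1)}\wedge\dots\wedge \mathrm d_\flat t^e_{\sigma(s+k-\ell)}$, $$\mathrm d_f\widehat\lambda_{[f\setminus e]}=\mathrm d_\flat\nabla_{e\cup\{m_1\}}\lambda_{m_1}\wedge\dots\wedge \mathrm d_\flat\nabla_{e\cup\{m_{\ell-s}\}}\lambda_{m_{\ell-s}},\qquad \mathrm d\lambda_{[f\setminus e]}=\mathrm d\lambda_{m_1}\wedge\dots\wedge \mathrm d\lambda_{m_{\ell-s}} .$$ Let $\mathbb P_r\Lambda^k(T)=\mathbb P_r(T)\otimes\operatorname{Alt}^k$,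 and let $\mathbb P_r\Lambda^k(\mathcal T_h)$ be the space of all $\omega\in L^2\Lambda^k(\Omega)$ such that $\omega|_T\in\mathbb P_r\Lambda^k(T)$ for all $T\in\mathcal T_h$ and, for all $(e,f,\sigma)\in I$ with $\ell\le d-1$ and all polynomials $q$ of degree at most $r-(s+1)$ (none if $r<s+1$), the moment $$\int_e\langle\omega|_T,\ \mathrm d_\flat t^e_\sigma\wedge \mathrm d_f\widehat\lambda_{[f\setminus e]}\rangle\,q\,\mathrm ds$$ is the same for all $T\in\mathcal T_h$ containing $f$ (if $e$ is a vertex the integral is the value at $e$). For a multi-index $\alpha$ on the vertices of $\mathcal T_h$ with $|\alpha|=r$ and support exactly $e$, let $x_\alpha=\frac1r\sum_i\alpha_i\texttt v_i$; these are the lattice points of degree $r$ in the interior of $e$. Let $$\phi_\alpha=\frac1{\alpha!}\prod_i\prod_{j=0}^{\alpha_i-1}(r\lambda_i-j)$$ on each $T$ be the Lagrange nodal basis function. For $(e,f,\sigma)\in I$ and $x_\alpha$ in the interior of $e$ define, for any $T\in\mathcal T_h$ with $f\subseteq T$, $$N^{\sigma,f}_\alpha(\omega)=\langle\omega|_T(x_\alpha),\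 \mathrm d_\flat t^e_\sigma\wedge \mathrm d_f\widehat\lambda_{[f\setminus e]}\rangle .$$ 1. The degrees of freedom are single-valued across $f$: for $\omega\in\mathbb P_r\Lambda^k(\mathcal T_h)$ the number $N^{\sigma,f}_\alpha(\omega)$ does not depend on the choice of $T\supseteq f$. 2. They are unisolvent: for any real numbers $c^{\sigma,f}_\alpha$ there is exactly one $\omega\in\mathbb P_r\Lambda^k(\mathcal T_h)$ with $N^{\sigma,f}_\alpha(\omega)=c^{\sigma,f}_\alpha$ for all indices. 3. The forms given on every $T\in\mathcal T_h$ by $\boldsymbol\phi^{\sigma,f}_\alpha=\phi_\alpha\,\mathrm d_\flat t^e_\sigma\wedge \mathrm d\lambda_{[f\setminus e]}$ are a basis of $\mathbb P_r\Lambda^k(\mathcal T_h)$ that is scaled dual to the degrees of freedom: each degree of freedom is nonzero on the basis form with the same index and zero on all the others. -/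

import Mathlib

open MeasureTheory
open scoped ENNReal

noncomputable section

namespace TNForms

/-- The ambient Euclidean space `ℝ^d`. -/
abbrev E (d : ℕ) : Type := EuclideanSpace ℝ (Fin d)

/-- Exterior `k`-forms on `ℝ^d` (continuity is automatic; it provides the norm used for `L²`). -/
abbrev Alt (d k : ℕ) : Type := E d [⋀^Fin k]→L[ℝ] ℝ

/-! ### Exterior algebra -/

/-- `d♭u₁ ∧ ⋯ ∧ d♭u_k`, that is `(v₁, …, v_k) ↦ det (⟨u_i, v_j⟩)`. -/
def wedgeFlat {d k : ℕ} (u : Fin k → E d) : Alt d k :=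
  { (Matrix.detRowAlternating (n := Fin k) (R := ℝ)).compLinearMap
      (LinearMap.pi fun i => (innerSL ℝ (u i)).toLinearMap) with
    cont := by
      change Continuous fun v : Fin k → E d =>
        Matrix.det (Matrix.of fun j i => inner ℝ (u i) (v j))
      refine Continuous.matrix_det ?_
      refine continuous_pi fun j => continuous_pi fun i => ?_
      exact (innerSL ℝ (u i)).continuous.comp (continuous_apply j) }

theorem wedgeFlat_apply {d k : ℕ} (u v : Fin k → E d) :
    wedgeFlat u v = Matrix.det (Matrix.of fun i j => inner ℝ (u i) (v j)) := by
  rw [← Matrix.det_transpose]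
  rfl

instance (m n : ℕ) : Fintype (Fin m ↪o Fin n) := Fintype.ofFinite _

/-- The inner product of exterior `k`-forms,
`⟨ω, η⟩ = ∑_{σ increasing} ω(e_{σ(1)}, …, e_{σ(k)}) η(e_{σ(1)}, …, e_{σ(k)})`,
with `e₁, …, e_d` the standard orthonormal basis of `ℝ^d`. -/
def altInner {d k : ℕ} (ω η : Alt d k) : ℝ :=
  ∑ σ : Fin k ↪o Fin d,
    ω (fun i => EuclideanSpace.basisFun (Fin d) ℝ (σ i)) *
      η (fun i => EuclideanSpace.basisFun (Fin d) ℝ (σ i))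

/-- Value of a polynomial in the Cartesian coordinates. -/
def polyEval {d : ℕ} (p : MvPolynomial (Fin d) ℝ) (x : E d) : ℝ :=
  MvPolynomial.eval (fun i => x i) p

/-- `ℙ_r ⊗ Alt^k`: differential `k`-forms with polynomial coefficients of degree at most `r`. -/
def polyForms (d k r : ℕ) : Submodule ℝ (E d → Alt d k) :=
  Submodule.span ℝ {F | ∃ (p : MvPolynomial (Fin d) ℝ) (a : Alt d k),
    p.totalDegree ≤ r ∧ F = fun x => polyEval p x • a}

/-! ### Meshes -/

/-- A finite conforming mesh of `d`-simplices in `ℝ^d`. Simplices and their sub-simplices are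
represented by their sets of vertex indices (global numbering). -/
structure Mesh (d : ℕ) where
  /-- number of vertices -/
  n : ℕ
  /-- positions of the vertices -/
  vert : Fin n → E d
  /-- the `d`-simplices of the mesh -/
  cells : Finset (Finset (Fin n))
  card_cell : ∀ T ∈ cells, T.card = d + 1
  affineIndependent_cell : ∀ T ∈ cells, AffineIndependent ℝ (fun i : T => vert i)
  /-- two simplices meet in the common sub-simplex spanned by their common vertices (possibly
  empty) -/
  conforming : ∀ T ∈ cells, ∀ T' ∈ cells,
    convexHull ℝ (vert '' (T : Set (Fin n))) ∩ convexHull ℝ (vert '' (T' : Set (Fin n))) =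
      convexHull ℝ (vert '' ((T ∩ T' : Finset (Fin n)) : Set (Fin n)))

namespace Mesh

variable {d : ℕ} (M : Mesh d)

/-- Geometric realization of a set of vertices. -/
def simplex (f : Finset (Fin M.n)) : Set (E d) :=
  convexHull ℝ (M.vert '' (f : Set (Fin M.n)))

/-- The region covered by the mesh. -/
def domain : Set (E d) := ⋃ T ∈ M.cells, M.simplex T

/-- `f ∈ Δ(𝒯_h)`: `f` is a (nonempty) sub-simplex of a simplex of the mesh. Its dimension is
`f.card - 1`. -/
def IsFace (f : Finset (Fin M.n)) : Prop := f.Nonempty ∧ ∃ T ∈ M.cells, f ⊆ T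

/-- The tangent space of the sub-simplex `f`. -/
def tangent (f : Finset (Fin M.n)) : Submodule ℝ (E d) :=
  vectorSpan ℝ (M.vert '' (f : Set (Fin M.n)))

/-- The vertices of a `d`-simplex of the mesh as an affine basis of `ℝ^d`. -/
def cellBasis (T : Finset (Fin M.n)) (hT : T ∈ M.cells) : AffineBasis T ℝ (E d) where
  toFun := fun i => M.vert i
  ind' := M.affineIndependent_cell T hT
  tot' := by
    rw [(M.affineIndependent_cell T hT).affineSpan_eq_top_iff_card_eq_finrank_add_one]
    simp [M.card_cell T hT]

open Classical in
/-- The barycentric coordinate `λ_i` of the `d`-simplex `T`. If `i` is not a vertex of `T` it is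
zero, the restriction to `T` of the global piecewise linear hat function at the vertex `i`. -/
def bary (T : Finset (Fin M.n)) (i : Fin M.n) : E d →ᵃ[ℝ] ℝ :=
  if h : T ∈ M.cells ∧ i ∈ T then (M.cellBasis T h.1).coord ⟨i, h.2⟩ else 0

/-- The (constant) gradient `∇λ_i` on the `d`-simplex `T`. -/
def gradBary (T : Finset (Fin M.n)) (i : Fin M.n) : E d :=
  (InnerProductSpace.toDual ℝ (E d)).symm (LinearMap.toContinuousLinearMap (M.bary T i).linear)

/-- The surface gradient `∇_g λ_i = Π_g ∇λ_i` on the sub-simplex `g` of `T`, with `Π_g` the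
orthogonal projection onto the tangent space of `g`. -/
def surfGrad (T g : Finset (Fin M.n)) (i : Fin M.n) : E d :=
  (M.tangent g).starProjection (M.gradBary T i)

/-- Global choices of orientations, attached to sub-simplices of the mesh and not to the elements
containing them: for every `e` an orthonormal frame `t_1^e, …, t_s^e` of its tangent space, and
for every pair `e ⊆ f` an ordering `[f ∖ e]` of the vertices of `f` that are not in `e` (for
instance the one that is increasing for the global numbering). -/
structure Orientation where
  tan : ∀ e : Finset (Fin M.n), Fin (e.card - 1) → E d
  orthonormal_tan : ∀ e, M.IsFace e → Orthonormal ℝ (tan e)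
  span_tan : ∀ e, M.IsFace e → Submodule.span ℝ (Set.range (tan e)) = M.tangent e
  ord : ∀ e f : Finset (Fin M.n), Fin (f \ e).card ≃ {i : Fin M.n // i ∈ f \ e}

/-- The triples `(e, f, σ)` with `e ⊆ f` sub-simplices of the mesh, `s = dim e`, `ℓ = dim f`,
`max{s, k} ≤ ℓ ≤ min{k + s, d}` and `σ ∈ Σ(s + k - ℓ, s)`. (The inequalities `s ≤ ℓ ≤ d` follow
from `e ⊆ f` and `f` being a sub-simplex; dimension is cardinality minus one.) -/
structure FormIndex (k : ℕ) where
  e : Finset (Fin M.n)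
  f : Finset (Fin M.n)
  isFace_e : M.IsFace e
  isFace_f : M.IsFace f
  e_subset : e ⊆ f
  le_dim : k + 1 ≤ f.card
  dim_le : f.card ≤ k + e.card
  σ : Fin (e.card + k - f.card) ↪o Fin (e.card - 1)

variable {M}

theorem FormIndex.card_eq {k : ℕ} (i : M.FormIndex k) :
    k = (i.e.card + k - i.f.card) + (i.f \ i.e).card := by
  have h1 := Finset.card_sdiff_of_subset i.e_subset
  have h2 := Finset.card_le_card i.e_subset
  have h3 := i.dim_le
  omega

/-- `d♭t^e_σ ∧ d♭w_1 ∧ ⋯ ∧ d♭w_{ℓ-s}`. -/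
def FormIndex.tnForm {k : ℕ} (i : M.FormIndex k) (O : M.Orientation)
    (w : Fin (i.f \ i.e).card → E d) : Alt d k :=
  wedgeFlat fun j => Fin.append (fun a => O.tan i.e (i.σ a)) w (Fin.cast i.card_eq j)

/-- `d♭t^e_σ ∧ d_f λ̂_{[f∖e]}`, where `d_f λ̂_{[f∖e]}` is the wedge product over `m ∈ [f∖e]` of the
1-forms `d_{e ∪ {m}} λ_m`. The barycentric coordinates are those of a simplex `T` containing
`f`. -/
def FormIndex.dofForm {k : ℕ} (i : M.FormIndex k) (O : M.Orientation)
    (T : Finset (Fin M.n)) : Alt d k :=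
  i.tnForm O fun b => M.surfGrad T (i.e ∪ {(O.ord i.e i.f b).1}) (O.ord i.e i.f b).1

/-- `d♭t^e_σ ∧ dλ_{[f∖e]}` on the simplex `T`. -/
def FormIndex.shapeForm {k : ℕ} (i : M.FormIndex k) (O : M.Orientation)
    (T : Finset (Fin M.n)) : Alt d k :=
  i.tnForm O fun b => M.gradBary T (O.ord i.e i.f b).1

/-- The moment `∫_e ⟨p, d♭t^e_σ ∧ d_f λ̂_{[f∖e]}⟩ q ds`, with respect to the `s`-dimensional surface
measure (point evaluation if `e` is a vertex). -/
def FormIndex.moment {k : ℕ} (i : M.FormIndex k) (O : M.Orientation) (T : Finset (Fin M.n))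
    (q : MvPolynomial (Fin d) ℝ) (p : E d → Alt d k) : ℝ :=
  ∫ x in M.simplex i.e, altInner (p x) (i.dofForm O T) * polyEval q x
    ∂(Measure.euclideanHausdorffMeasure (i.e.card - 1))

/-! ### Facts needed for the definition of the finite element space -/

theorem simplex_subset_domain {T : Finset (Fin M.n)} (hT : T ∈ M.cells) :
    M.simplex T ⊆ M.domain :=
  Set.subset_biUnion_of_mem (u := fun T => M.simplex T) hT

theorem isCompact_simplex (f : Finset (Fin M.n)) : IsCompact (M.simplex f) :=
  (f.finite_toSet.image M.vert).isCompact_convexHull (𝕜 := ℝ)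

theorem measure_simplex_lt_top (f : Finset (Fin M.n)) :
    Measure.euclideanHausdorffMeasure (f.card - 1) (M.simplex f) < ∞ := by
  rcases f.eq_empty_or_nonempty with rfl | ⟨i₀, hi₀⟩
  · simp [simplex]
  set F : Finset (Fin M.n) := f.erase i₀ with hF
  set L : (F → ℝ) →L[ℝ] E d :=
    ∑ j : F,
      (ContinuousLinearMap.proj j : (F → ℝ) →L[ℝ] ℝ).smulRight
        (M.vert j - M.vert i₀) with hL
  have hLapp : ∀ y, L y = ∑ j, y j • (M.vert j - M.vert i₀) := by
    intro y
    simp [hL]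
  set g : (F → ℝ) → E d := fun y => M.vert i₀ + L y with hg
  have hlip := (LipschitzWith.const (α := F → ℝ)
    (M.vert i₀)).add L.lipschitz
  have hsub : M.simplex f ⊆ g '' Set.Icc 0 1 := by
    refine convexHull_min ?_ ?_
    · rintro _ ⟨j, hj, rfl⟩
      by_cases hji : j = i₀
      · subst hji
        exact ⟨0, ⟨le_rfl, zero_le_one⟩, by simp [hg]⟩
      · have hj' : j ∈ F := Finset.mem_erase.2 ⟨hji, hj⟩
        refine ⟨Pi.single ⟨j, hj'⟩ 1, ⟨?_, ?_⟩, ?_⟩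
        · exact Pi.single_nonneg.2 zero_le_one
        · intro a
          by_cases ha : a = ⟨j, hj'⟩
          · subst ha; simp
          · simp [Pi.single_eq_of_ne ha]
        · simp only [hg, hLapp]
          rw [Finset.sum_eq_single ⟨j, hj'⟩]
          · simp
          · intro b _ hb
            simp [Pi.single_eq_of_ne hb]
          · simp
    · have : g '' Set.Icc 0 1 = (fun z => M.vert i₀ + z) '' (L.toLinearMap '' Set.Icc 0 1) := by
        rw [Set.image_image]; rfl
      rw [this]
      exact ((convex_Icc _ _).linear_image _).translate _
  have hcard : Fintype.card F = f.card - 1 := by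
    rw [Fintype.card_coe, hF, Finset.card_erase_of_mem hi₀]
  have hcube : Measure.hausdorffMeasure ((f.card - 1 : ℕ) : ℝ)
      (Set.Icc (0 : F → ℝ) 1) < ∞ := by
    rw [← hcard, hausdorffMeasure_pi_real]
    exact isCompact_Icc.measure_lt_top
  have hH : Measure.hausdorffMeasure ((f.card - 1 : ℕ) : ℝ) (M.simplex f) < ∞ := by
    refine lt_of_le_of_lt (measure_mono hsub) ?_
    refine lt_of_le_of_lt (hlip.hausdorffMeasure_image_le (Nat.cast_nonneg _) _) ?_
    exact ENNReal.mul_lt_top (ENNReal.rpow_lt_top_of_nonneg (Nat.cast_nonneg _)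
      ENNReal.coe_ne_top) hcube
  rw [Measure.euclideanHausdorffMeasure_def, Measure.smul_apply, ENNReal.smul_def, smul_eq_mul]
  exact ENNReal.mul_lt_top ENNReal.coe_lt_top hH

theorem continuous_of_mem_polyForms {k r : ℕ} {p : E d → Alt d k} (hp : p ∈ polyForms d k r) :
    Continuous p := by
  refine Submodule.span_induction ?_ continuous_zero (fun x y _ _ hx hy => hx.add hy)
    (fun c x _ hx => hx.const_smul c) hp
  rintro _ ⟨q, a, -, rfl⟩
  have h : Continuous fun x : E d => polyEval q x :=
    (MvPolynomial.continuous_eval q).comp (continuous_pi fun i => by fun_prop)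
  exact h.smul continuous_const

theorem integrable_moment {k r : ℕ} (i : M.FormIndex k) (O : M.Orientation)
    (T : Finset (Fin M.n)) (q : MvPolynomial (Fin d) ℝ) {p : E d → Alt d k}
    (hp : p ∈ polyForms d k r) :
    IntegrableOn (fun x => altInner (p x) (i.dofForm O T) * polyEval q x) (M.simplex i.e)
      (Measure.euclideanHausdorffMeasure (i.e.card - 1)) := by
  have hc := continuous_of_mem_polyForms hp
  have hq : Continuous fun x : E d => polyEval q x :=
    (MvPolynomial.continuous_eval q).comp (continuous_pi fun i => by fun_prop)
  have h1 : Continuous fun x => altInner (p x) (i.dofForm O T) := by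
    unfold altInner
    refine continuous_finsetSum _ fun σ _ => Continuous.mul ?_ continuous_const
    exact (ContinuousAlternatingMap.apply ℝ (E d) ℝ
      (fun i => EuclideanSpace.basisFun (Fin d) ℝ (σ i))).continuous.comp hc
  have hK := isCompact_simplex (M := M) i.e
  obtain ⟨C, hC⟩ := hK.exists_bound_of_continuousOn (h1.mul hq).continuousOn
  exact Measure.integrableOn_of_bounded (measure_simplex_lt_top i.e).ne
    (h1.mul hq).aestronglyMeasurable
    ((ae_restrict_iff' hK.measurableSet).2 (Filter.Eventually.of_forall hC))

theorem FormIndex.moment_add {k r : ℕ} (i : M.FormIndex k) (O : M.Orientation)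
    (T : Finset (Fin M.n)) (q : MvPolynomial (Fin d) ℝ) {p p' : E d → Alt d k}
    (hp : p ∈ polyForms d k r) (hp' : p' ∈ polyForms d k r) :
    i.moment O T q (p + p') = i.moment O T q p + i.moment O T q p' := by
  unfold FormIndex.moment
  rw [← integral_add (integrable_moment i O T q hp) (integrable_moment i O T q hp')]
  congr 1
  ext x
  simp [altInner, add_mul, Finset.sum_add_distrib]

theorem FormIndex.moment_smul {k : ℕ} (i : M.FormIndex k) (O : M.Orientation)
    (T : Finset (Fin M.n)) (q : MvPolynomial (Fin d) ℝ) (c : ℝ) (p : E d → Alt d k) :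
    i.moment O T q (c • p) = c * i.moment O T q p := by
  unfold FormIndex.moment
  rw [← integral_const_mul]
  congr 1
  ext x
  simp [altInner, Finset.mul_sum, Finset.sum_mul, mul_assoc]

/-! ### The finite element space, the degrees of freedom and the shape functions -/

variable (M) in
/-- `L²Λ^k(Ω)`. -/
abbrev L2Forms (k : ℕ) : Type := Lp (Alt d k) 2 (volume.restrict M.domain)

variable (M) in
/-- `p` is a form with polynomial coefficients of degree at most `r` that represents the
restriction of `ω` to `T`. -/
def IsPiece {k : ℕ} (r : ℕ) (ω : M.L2Forms k) (T : Finset (Fin M.n)) (p : E d → Alt d k) : Prop :=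
  p ∈ polyForms d k r ∧ ω =ᵐ[volume.restrict (M.simplex T)] p

variable (M) in
/-- The global space `ℙ_rΛ^k(𝒯_h)`: forms in `L²Λ^k(Ω)` whose restriction to every `T ∈ 𝒯_h` lies in
`ℙ_rΛ^k(T)` and whose moments `∫_e ⟨ω, d♭t^e_σ ∧ d_f λ̂_{[f∖e]}⟩ q ds`, `q ∈ ℙ_{r-(s+1)}(e)`, are
single-valued across every `f ∈ Δ_ℓ(𝒯_h)`, `k ≤ ℓ ≤ d - 1`. -/
def feSpace (O : M.Orientation) (k r : ℕ) : Submodule ℝ (M.L2Forms k) where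
  carrier := {ω | ∃ p : Finset (Fin M.n) → E d → Alt d k,
    (∀ T ∈ M.cells, M.IsPiece r ω T (p T)) ∧
    ∀ i : M.FormIndex k, i.f.card ≤ d →
      ∀ T ∈ M.cells, ∀ T' ∈ M.cells, i.f ⊆ T → i.f ⊆ T' →
        ∀ q : MvPolynomial (Fin d) ℝ, q.totalDegree + i.e.card ≤ r →
          i.moment O T q (p T) = i.moment O T' q (p T')}
  zero_mem' := by
    refine ⟨0, fun T hT => ⟨Submodule.zero_mem _, ?_⟩, ?_⟩
    · exact ae_mono (Measure.restrict_mono (simplex_subset_domain hT) le_rfl)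
        (Lp.coeFn_zero (Alt d k) 2 (volume.restrict M.domain))
    · intro i _ T _ T' _ _ _ q _
      simp [FormIndex.moment, altInner]
  add_mem' := by
    rintro ω ω' ⟨p, hp, hs⟩ ⟨p', hp', hs'⟩
    refine ⟨p + p', fun T hT => ⟨Submodule.add_mem _ (hp T hT).1 (hp' T hT).1, ?_⟩, ?_⟩
    · have h : ⇑(ω + ω') =ᵐ[volume.restrict (M.simplex T)] ⇑ω + ⇑ω' :=
        ae_mono (Measure.restrict_mono (simplex_subset_domain hT) le_rfl) (Lp.coeFn_add ω ω')
      exact h.trans ((hp T hT).2.add (hp' T hT).2)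
    · intro i hi T hT T' hT' hf hf' q hq
      rw [Pi.add_apply, Pi.add_apply, i.moment_add O T q (hp T hT).1 (hp' T hT).1,
        i.moment_add O T' q (hp T' hT').1 (hp' T' hT').1,
        hs i hi T hT T' hT' hf hf' q hq, hs' i hi T hT T' hT' hf hf' q hq]
  smul_mem' := by
    rintro c ω ⟨p, hp, hs⟩
    refine ⟨c • p, fun T hT => ⟨Submodule.smul_mem _ c (hp T hT).1, ?_⟩, ?_⟩
    · have h : ⇑(c • ω) =ᵐ[volume.restrict (M.simplex T)] c • ⇑ω :=
        ae_mono (Measure.restrict_mono (simplex_subset_domain hT) le_rfl) (Lp.coeFn_smul c ω)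
      exact h.trans ((hp T hT).2.const_smul c)
    · intro i hi T hT T' hT' hf hf' q hq
      rw [Pi.smul_apply, Pi.smul_apply, i.moment_smul, i.moment_smul,
        hs i hi T hT T' hT' hf hf' q hq]

variable (M) in
open Classical in
/-- The polynomial form `ω|_T` (junk value zero if `ω` is not polynomial on `T`). -/
def piece {k : ℕ} (r : ℕ) (ω : M.L2Forms k) (T : Finset (Fin M.n)) : E d → Alt d k :=
  if h : ∃ p, M.IsPiece r ω T p then h.choose else 0

variable (M) in
/-- Indices of the nodal degrees of freedom: `(e, f, σ)` together with a lattice point of degree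
`r` interior to `e`, i.e. a multi-index on the vertices of sum `r` whose support is `e`. -/
structure DofIndex (k r : ℕ) extends M.FormIndex k where
  α : Fin M.n → ℕ
  sum_α : ∑ m, α m = r
  support_α : ∀ m, α m ≠ 0 ↔ m ∈ e

variable (M) in
/-- The interpolation point `x_α = (1/r) ∑ α_m v_m`. -/
def latticePoint (r : ℕ) (α : Fin M.n → ℕ) : E d :=
  (1 / (r : ℝ)) • ∑ m, (α m : ℝ) • M.vert m

variable (M) in
/-- The Lagrange nodal basis function `φ_α = (1/α!) ∏_m ∏_{j < α_m} (r λ_m - j)` on the simplex `T`.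
It vanishes on `T` if the support of `α` is not contained in `T`. -/
def lagrange (r : ℕ) (α : Fin M.n → ℕ) (T : Finset (Fin M.n)) (x : E d) : ℝ :=
  (1 / ((∏ m, (α m).factorial : ℕ) : ℝ)) *
    ∏ m, ∏ j ∈ Finset.range (α m), ((r : ℝ) * M.bary T m x - (j : ℝ))

/-- The nodal degree of freedom `N_α^{σ,f}(ω) = ⟨ω(x_α), d♭t^e_σ ∧ d_f λ̂_{[f∖e]}⟩`, computed from the
simplex `T`. -/
def DofIndex.nodal {k r : ℕ} (i : M.DofIndex k r) (O : M.Orientation) (T : Finset (Fin M.n))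
    (ω : M.L2Forms k) : ℝ :=
  altInner (M.piece r ω T (M.latticePoint r i.α)) (i.dofForm O T)

/-- The form `φ_α d♭t^e_σ ∧ dλ_{[f∖e]}` on the simplex `T`. -/
def DofIndex.shape {k r : ℕ} (i : M.DofIndex k r) (O : M.Orientation) (T : Finset (Fin M.n))
    (x : E d) : Alt d k :=
  M.lagrange r i.α T x • i.shapeForm O T

end Mesh
end TNForms
end

noncomputable section

namespace TNForms

/-! ### Exterior algebra -/

/-! Pairing a form with `d♭v₁ ∧ ⋯ ∧ d♭v_k` is the same as evaluating it at `(v₁, …, v_k)`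
(`altInner_wedgeFlat`), so a degree of freedom evaluates `ω(x_α)` at `k` vectors. Fix a simplex `T`
and a sub-simplex `e`. The vectors `t^e_a` and `∇_{e ∪ m} λ_m`, `m ∈ T ∖ e`, span `ℝ^d`, and
choosing `k` of them is the same as choosing `(f, σ)`: the gradients chosen give `f ∖ e`, the
tangents chosen give `σ`. Hence the degrees of freedom at one lattice point determine the form there
(`eq_zero_of_dofs`). The frame `t^e_a, ∇λ_m` is biorthogonal to this one up to nonzero factors,
because `∇λ_m` is normal to every sub-simplex of `T` without the vertex `m`. The pairing of the
exterior factors at a fixed `e` is therefore diagonal, and multiplying by the Lagrange functions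
gives the scaled duality (`DofIndex.altInner_shape_dofForm`).

The global statements rest on the fact that the vectors of `(e, f, σ)` lie in the tangent space of
`f` and are the same for all `T ⊇ f`. Tangential components of `∇λ_m` on `f`, and the values of
`λ_m` on `f`, do not depend on `T` either, so the shape forms have single-valued moments and belong
to the space (`DofIndex.exists_mem_feSpace`).

Conversely, single-valued moments give single-valued nodal values (`altInner_piece_eq`). For the
difference of two pieces all moments on the sub-simplices of `f` vanish, and
`tangential_eq_zero_of_moments` shows by induction on `e ⊆ f` that it has no tangential part on `f`
at the points of `e`. By induction only the interior Lagrange functions of `e` survive in the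
pairing; these are the bubble `∏ λ_m` times polynomials of the degree that the moments test, so
testing with the cofactor `Q` makes the integral of bubble times `Q²` vanish.

What remains is linear algebra: a finite family dual up to scaling to functionals that separate
points is a basis. -/

theorem exists_perm_of_range_eq {ι β : Type*} {f g : ι → β} (hf : f.Injective)
    (hg : g.Injective) (h : Set.range f = Set.range g) : ∃ π : Equiv.Perm ι, f = g ∘ π := by
  refine ⟨(Equiv.ofInjective f hf).trans
    ((Equiv.setCongr h).trans (Equiv.ofInjective g hg).symm), funext fun i => ?_⟩
  have := Equiv.apply_ofInjective_symm hg (Equiv.setCongr h (Equiv.ofInjective f hf i))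
  simpa using this.symm

/-- Reordering the arguments only changes the sign. Since only vanishing is ever compared, no signs
have to be tracked. -/
theorem alternating_apply_eq_zero_of_range_eq {d k : ℕ} {ι : Type*} (η : Alt d k) (b : ι → E d)
    {f g : Fin k → ι} (hf : f.Injective) (hg : g.Injective) (h : Set.range f = Set.range g)
    (h0 : η (b ∘ g) = 0) : η (b ∘ f) = 0 := by
  obtain ⟨π, rfl⟩ := exists_perm_of_range_eq hf hg h
  have := η.toAlternatingMap.map_perm (b ∘ g) π
  change η ((b ∘ g) ∘ π) = _ at this
  rw [← Function.comp_assoc, this]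
  simp [h0]

/-- A form that vanishes on all tuples of distinct members of a family vanishes on the span. -/
theorem alternating_apply_eq_zero_of_mem_span {d k : ℕ} {ι : Type*} (η : Alt d k) (b : ι → E d)
    (h : ∀ ρ : Fin k → ι, ρ.Injective → η (b ∘ ρ) = 0) (v : Fin k → E d)
    (hv : ∀ j, v j ∈ Submodule.span ℝ (Set.range b)) : η v = 0 := by
  have h' : ∀ ρ : Fin k → ι, η (b ∘ ρ) = 0 := by
    intro ρ
    by_cases hρ : ρ.Injective
    · exact h ρ hρ
    · simp only [Function.Injective, not_forall] at hρ
      obtain ⟨i, j, hij, hne⟩ := hρ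
      exact η.map_eq_zero_of_eq _ (by simp [hij]) hne
  -- Multilinear expansion one slot at a time: `s` is the set of slots that may still hold an
  -- arbitrary vector of the span, the other slots already hold members of the family.
  have key : ∀ (s : Finset (Fin k)) (w : Fin k → E d),
      (∀ j ∈ s, w j ∈ Submodule.span ℝ (Set.range b)) → (∀ j ∉ s, w j ∈ Set.range b) →
        η w = 0 := by
    intro s
    induction s using Finset.induction_on with
    | empty =>
      intro w _ hw
      choose ρ hρ using fun j => hw j (Finset.notMem_empty j)
      rw [← h' ρ]
      exact congrArg η (funext fun j => (hρ j).symm)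
    | insert a s ha ih =>
      intro w hw hw'
      have hupd : ∀ x ∈ Submodule.span ℝ (Set.range b), η (Function.update w a x) = 0 := by
        intro x hx
        induction hx using Submodule.span_induction with
        | mem x hx =>
          refine ih _ (fun j hj => ?_) (fun j hj => ?_)
          · have : j ≠ a := fun e => ha (e ▸ hj)
            rw [Function.update_of_ne this]
            exact hw j (Finset.mem_insert_of_mem hj)
          · by_cases e : j = a
            · subst e; simpa using hx
            · rw [Function.update_of_ne e]
              exact hw' j (by simp [e, hj])
        | zero => exact η.map_coord_zero a (by simp)
        | add x y _ _ hx hy => rw [η.map_update_add, hx, hy, add_zero]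
        | smul c x _ hx => rw [η.map_update_smul, hx, smul_zero]
      have := hupd (w a) (hw a (Finset.mem_insert_self a s))
      rwa [Function.update_eq_self] at this
  exact key Finset.univ v (fun j _ => hv j) (fun j hj => absurd (Finset.mem_univ j) hj)

/-- `⟨ω, η⟩` is additive in `ω`. -/
theorem altInner_sub_left {d k : ℕ} (ω ω' η : Alt d k) :
    altInner (ω - ω') η = altInner ω η - altInner ω' η := by
  simp [altInner, sub_mul, Finset.sum_sub_distrib]

/-- The pairing with `d♭v₁ ∧ ⋯ ∧ d♭v_k` is the evaluation at `(v₁, …, v_k)`. -/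
theorem altInner_wedgeFlat {d k : ℕ} (η : Alt d k) (v : Fin k → E d) :
    altInner η (wedgeFlat v) = η v := by
  set B := EuclideanSpace.basisFun (Fin d) ℝ with hB
  have hdet : ∀ w : Fin k → E d, ∀ σ : Fin k ↪o Fin d,
      wedgeFlat w (fun i => B (σ i)) = wedgeFlat (fun i => B (σ i)) w := by
    intro w σ
    rw [wedgeFlat_apply, wedgeFlat_apply, ← Matrix.det_transpose]
    congr 1
    ext i j
    simp [real_inner_comm]
  -- `D` is the expansion of `η` in the standard basis of alternating forms. As `hdet` makes the
  -- determinant symmetric in its two lists of vectors, the claim becomes `D = η`.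
  let D : Alt d k := ∑ σ : Fin k ↪o Fin d, η (fun i => B (σ i)) • wedgeFlat (fun i => B (σ i))
  have hD : ∀ w, altInner η (wedgeFlat w) = D w := by
    intro w
    simp only [altInner, D, ContinuousAlternatingMap.sum_apply, ContinuousAlternatingMap.smul_apply,
      smul_eq_mul, ← hB]
    exact Finset.sum_congr rfl fun σ _ => by rw [hdet]
  rw [hD]
  have hmem : ∀ x : E d, x ∈ Submodule.span ℝ (Set.range B) := by
    intro x
    rw [← OrthonormalBasis.coe_toBasis, B.toBasis.span_eq]
    trivial
  suffices h : (D - η) v = 0 by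
    rw [ContinuousAlternatingMap.sub_apply] at h
    linarith
  refine alternating_apply_eq_zero_of_mem_span _ B (fun ρ hρ => ?_) v fun j => hmem _
  -- A tuple of distinct basis vectors may be sorted, and on increasing tuples the wedges of basis
  -- vectors are dual to the evaluations.
  have hmono : StrictMono (ρ ∘ Tuple.sort ρ) :=
    (Tuple.monotone_sort ρ).strictMono_of_injective (hρ.comp (Tuple.sort ρ).injective)
  let τ : Fin k ↪o Fin d := OrderEmbedding.ofStrictMono _ hmono
  refine alternating_apply_eq_zero_of_range_eq _ B hρ τ.injective ?_ ?_
  · exact (EquivLike.range_comp ρ (Tuple.sort ρ)).symm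
  · have hone : wedgeFlat (fun i => B (τ i)) (B ∘ τ) = 1 := by
      rw [wedgeFlat_apply]
      convert Matrix.det_one (n := Fin k) (R := ℝ)
      ext i j
      simp [B.inner_eq_ite, Matrix.one_apply, τ.injective.eq_iff]
    have hzero : ∀ σ : Fin k ↪o Fin d, σ ≠ τ → wedgeFlat (fun i => B (σ i)) (B ∘ τ) = 0 := by
      intro σ hσ
      -- Otherwise the range of `σ` would lie in that of `τ`; both have `k` elements, and an
      -- increasing map is determined by its range.
      have : ∃ i, ∀ j, σ i ≠ τ j := by
        by_contra! hc
        refine hσ (OrderEmbedding.range_inj.1 ?_)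
        have hsub : Finset.univ.image σ ⊆ Finset.univ.image τ := by
          intro x hx
          obtain ⟨i, -, rfl⟩ := Finset.mem_image.1 hx
          obtain ⟨j, hj⟩ := hc i
          exact Finset.mem_image.2 ⟨j, Finset.mem_univ _, hj.symm⟩
        have heq := Finset.eq_of_subset_of_card_le hsub (by
          rw [Finset.card_image_of_injective _ τ.injective,
            Finset.card_image_of_injective _ σ.injective])
        have := congrArg (fun s : Finset (Fin d) => (s : Set (Fin d))) heq
        simpa using this
      obtain ⟨i, hi⟩ := this
      rw [wedgeFlat_apply]
      refine Matrix.det_eq_zero_of_row_eq_zero i fun j => ?_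
      simp [B.inner_eq_ite, hi j]
    rw [ContinuousAlternatingMap.sub_apply, sub_eq_zero]
    simp only [D, ContinuousAlternatingMap.sum_apply, ContinuousAlternatingMap.smul_apply,
      smul_eq_mul]
    rw [Finset.sum_eq_single τ (fun σ _ hσ => by rw [hzero σ hσ, mul_zero])
      (fun h => absurd (Finset.mem_univ _) h), hone, mul_one]
    rfl

namespace Mesh

variable {d : ℕ} {M : Mesh d}

/-! ### Barycentric coordinates -/

theorem bary_vert {T : Finset (Fin M.n)} (hT : T ∈ M.cells) (i : Fin M.n) {a : Fin M.n}
    (ha : a ∈ T) : M.bary T i (M.vert a) = if i = a then 1 else 0 := by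
  classical
  unfold bary
  split_ifs with h h' h'
  · subst h'
    exact (M.cellBasis T hT).coord_apply_eq ⟨i, ha⟩
  · exact (M.cellBasis T hT).coord_apply_ne (i := ⟨i, h.2⟩) (j := ⟨a, ha⟩)
      (fun e => h' (congrArg Subtype.val e))
  · subst h'
    exact absurd ⟨hT, ha⟩ h
  · rfl

theorem inner_gradBary (T : Finset (Fin M.n)) (i : Fin M.n) (v : E d) :
    inner ℝ (M.gradBary T i) v = (M.bary T i).linear v := by
  simp [gradBary]

theorem inner_gradBary_sub {T : Finset (Fin M.n)} (hT : T ∈ M.cells) (i : Fin M.n)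
    {a b : Fin M.n} (ha : a ∈ T) (hb : b ∈ T) :
    inner ℝ (M.gradBary T i) (M.vert a - M.vert b) =
      (if i = a then 1 else 0) - (if i = b then 1 else 0) := by
  rw [inner_gradBary, ← bary_vert hT i ha, ← bary_vert hT i hb, ← vsub_eq_sub,
    AffineMap.linearMap_vsub, vsub_eq_sub]

/-- The affine functions are determined by their values at the vertices. -/
theorem affine_combination_eq (F : E d →ᵃ[ℝ] ℝ) {s : Finset (Fin M.n)} {w : Fin M.n → ℝ}
    (hw : ∑ m ∈ s, w m = 1) :
    F (∑ m ∈ s, w m • M.vert m) = ∑ m ∈ s, w m * F (M.vert m) := by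
  have h : ∀ x, F x = F.linear x + F 0 := fun x => by
    have := F.map_vadd 0 x
    simpa using this
  rw [h, map_sum]
  simp_rw [map_smul, smul_eq_mul, h (M.vert _), mul_add, Finset.sum_add_distrib,
    ← Finset.sum_mul, hw, one_mul]

theorem bary_sum_smul_vert {T : Finset (Fin M.n)} (hT : T ∈ M.cells) (i : Fin M.n)
    {w : Fin M.n → ℝ} (hw : ∑ m ∈ T, w m = 1) :
    M.bary T i (∑ m ∈ T, w m • M.vert m) = if i ∈ T then w i else 0 := by
  rw [affine_combination_eq _ hw,
    Finset.sum_congr rfl fun m hm => by rw [bary_vert hT i hm, mul_ite, mul_one, mul_zero]]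
  simp

theorem sum_bary {T : Finset (Fin M.n)} (hT : T ∈ M.cells) (x : E d) :
    ∑ m ∈ T, M.bary T m x = 1 := by
  rw [← Finset.sum_coe_sort, ← (M.cellBasis T hT).sum_coord_apply_eq_one x]
  exact Finset.sum_congr rfl fun m _ => by simp [bary, hT]

theorem sum_bary_smul {T : Finset (Fin M.n)} (hT : T ∈ M.cells) (x : E d) :
    ∑ m ∈ T, M.bary T m x • M.vert m = x := by
  have h := (M.cellBasis T hT).linear_combination_coord_eq_self x
  rw [← Finset.sum_coe_sort]
  refine Eq.trans (Finset.sum_congr rfl fun m _ => ?_) h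
  simp only [bary, hT, m.2, and_self, dif_pos]
  rfl

/-- The sub-simplex `e` of `T` is where the barycentric coordinates are nonnegative and those of
the vertices off `e` vanish. -/
theorem mem_simplex_iff {T e : Finset (Fin M.n)} (hT : T ∈ M.cells) (he : e ⊆ T) (x : E d) :
    x ∈ M.simplex e ↔ (∀ m ∈ e, 0 ≤ M.bary T m x) ∧ ∀ m, m ∉ e → M.bary T m x = 0 := by
  constructor
  · let C : Set (E d) := {y | (∀ m ∈ e, 0 ≤ M.bary T m y) ∧ ∀ m, m ∉ e → M.bary T m y = 0}
    have hC : Convex ℝ C := by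
      intro y hy z hz a b ha hb hab
      have key : ∀ m, M.bary T m (a • y + b • z) = a * M.bary T m y + b * M.bary T m z := by
        intro m
        exact Convex.combo_affine_apply hab
      refine ⟨fun m hm => ?_, fun m hm => ?_⟩
      · rw [key]
        exact add_nonneg (mul_nonneg ha (hy.1 m hm)) (mul_nonneg hb (hz.1 m hm))
      · rw [key, hy.2 m hm, hz.2 m hm, mul_zero, mul_zero, add_zero]
    refine fun hx => convexHull_min (t := C) ?_ hC hx
    rintro _ ⟨a, ha, rfl⟩
    refine ⟨fun m _ => ?_, fun m hm => ?_⟩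
    · rw [bary_vert hT m (he ha)]
      split_ifs <;> norm_num
    · rw [bary_vert hT m (he ha), if_neg]
      rintro rfl
      exact hm ha
  · rintro ⟨h1, h2⟩
    have hs : ∑ m ∈ e, M.bary T m x = 1 := by
      rw [← sum_bary hT x]
      exact Finset.sum_subset he fun m _ hm => h2 m hm
    have hx : x = ∑ m ∈ e, M.bary T m x • M.vert m := by
      conv_lhs => rw [← sum_bary_smul hT x]
      exact (Finset.sum_subset he fun m _ hm => by rw [h2 m hm, zero_smul]).symm
    rw [hx]
    exact (convex_convexHull ℝ _).sum_mem h1 hs fun m hm =>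
      subset_convexHull ℝ _ ⟨m, hm, rfl⟩

/-- The barycentric coordinates on a common sub-simplex of two simplices agree. -/
theorem bary_eq_of_mem_simplex {T T' f : Finset (Fin M.n)} (hT : T ∈ M.cells)
    (hT' : T' ∈ M.cells) (hf : f ⊆ T) (hf' : f ⊆ T') {x : E d} (hx : x ∈ M.simplex f)
    (i : Fin M.n) : M.bary T i x = M.bary T' i x := by
  obtain ⟨h1, h2⟩ := (mem_simplex_iff hT hf x).1 hx
  have hs : ∑ m ∈ f, M.bary T m x = 1 := by
    rw [← sum_bary hT x]
    exact Finset.sum_subset hf fun m _ hm => h2 m hm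
  have hx' : x = ∑ m ∈ f, M.bary T m x • M.vert m := by
    conv_lhs => rw [← sum_bary_smul hT x]
    exact (Finset.sum_subset hf fun m _ hm => by rw [h2 m hm, zero_smul]).symm
  have key : M.bary T' i x = ∑ m ∈ f, M.bary T m x * M.bary T' i (M.vert m) := by
    conv_lhs => rw [hx']
    exact affine_combination_eq _ hs
  rw [key, Finset.sum_congr rfl fun m hm => by
    rw [bary_vert hT' i (hf' hm), mul_ite, mul_one, mul_zero]]
  by_cases hi : i ∈ f
  · simp [hi]
  · simp [hi, h2 i hi]

/-! ### Tangent spaces and gradients -/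

theorem sub_mem_tangent {f : Finset (Fin M.n)} {a b : Fin M.n} (ha : a ∈ f) (hb : b ∈ f) :
    M.vert a - M.vert b ∈ M.tangent f :=
  vsub_mem_vectorSpan ℝ ⟨a, ha, rfl⟩ ⟨b, hb, rfl⟩

theorem tangent_mono {e f : Finset (Fin M.n)} (h : e ⊆ f) : M.tangent e ≤ M.tangent f :=
  vectorSpan_mono ℝ (Set.image_mono h)

theorem tangent_le {f : Finset (Fin M.n)} {m₀ : Fin M.n} (hm₀ : m₀ ∈ f)
    {S : Submodule ℝ (E d)} (h : ∀ m ∈ f, M.vert m - M.vert m₀ ∈ S) : M.tangent f ≤ S := by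
  unfold tangent
  have h₀ : M.vert m₀ ∈ M.vert '' (f : Set (Fin M.n)) := ⟨m₀, hm₀, rfl⟩
  rw [vectorSpan_eq_span_vsub_set_right ℝ h₀, Submodule.span_le]
  rintro _ ⟨_, ⟨m, hm, rfl⟩, rfl⟩
  exact h m hm

/-- `∇λ_i` is normal to the sub-simplices that do not contain the vertex `i`. -/
theorem inner_gradBary_eq_zero {T f : Finset (Fin M.n)} (hT : T ∈ M.cells) (hf : f ⊆ T)
    {i : Fin M.n} (hi : i ∉ f) {v : E d} (hv : v ∈ M.tangent f) :
    inner ℝ (M.gradBary T i) v = 0 := by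
  rcases f.eq_empty_or_nonempty with rfl | ⟨m₀, hm₀⟩
  · simp only [tangent, Finset.coe_empty, Set.image_empty, vectorSpan_empty,
      Submodule.mem_bot] at hv
    simp [hv]
  · have : M.tangent f ≤ LinearMap.ker (innerSL ℝ (M.gradBary T i)).toLinearMap := by
      refine tangent_le hm₀ fun m hm => ?_
      have h1 : i ≠ m := fun e => hi (e ▸ hm)
      have h2 : i ≠ m₀ := fun e => hi (e ▸ hm₀)
      simpa [h1, h2] using inner_gradBary_sub hT i (hf hm) (hf hm₀)
    simpa using this hv

/-- Tangential components of `∇λ_i` on a common sub-simplex of two simplices agree. -/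
theorem inner_gradBary_congr {T T' f : Finset (Fin M.n)} (hT : T ∈ M.cells)
    (hT' : T' ∈ M.cells) (hf : f ⊆ T) (hf' : f ⊆ T') (i : Fin M.n) {v : E d}
    (hv : v ∈ M.tangent f) :
    inner ℝ (M.gradBary T i) v = inner ℝ (M.gradBary T' i) v := by
  rcases f.eq_empty_or_nonempty with rfl | ⟨m₀, hm₀⟩
  · simp only [tangent, Finset.coe_empty, Set.image_empty, vectorSpan_empty,
      Submodule.mem_bot] at hv
    simp [hv]
  · have : M.tangent f ≤
        LinearMap.ker (innerSL ℝ (M.gradBary T i - M.gradBary T' i)).toLinearMap := by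
      refine tangent_le hm₀ fun m hm => ?_
      have h1 := inner_gradBary_sub hT i (hf hm) (hf hm₀)
      have h2 := inner_gradBary_sub hT' i (hf' hm) (hf' hm₀)
      have : inner ℝ (M.gradBary T i - M.gradBary T' i) (M.vert m - M.vert m₀) = 0 := by
        rw [inner_sub_left, h1, h2, sub_self]
      exact this
    have h' : inner ℝ (M.gradBary T i - M.gradBary T' i) v = 0 := this hv
    rwa [inner_sub_left, sub_eq_zero] at h'

theorem surfGrad_mem (T g : Finset (Fin M.n)) (i : Fin M.n) : M.surfGrad T g i ∈ M.tangent g :=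
  Submodule.starProjection_apply_mem _ _

theorem inner_surfGrad (T g : Finset (Fin M.n)) (i : Fin M.n) {v : E d} (hv : v ∈ M.tangent g) :
    inner ℝ (M.surfGrad T g i) v = inner ℝ (M.gradBary T i) v := by
  have h := Submodule.starProjection_inner_eq_zero (K := M.tangent g) (M.gradBary T i) v hv
  rw [inner_sub_left, sub_eq_zero] at h
  exact h.symm

/-- The difference is tangent to `g`, and its inner products with tangent vectors of `g` vanish, so
it is orthogonal to itself. -/
theorem surfGrad_congr {T T' g : Finset (Fin M.n)} (hT : T ∈ M.cells)
    (hT' : T' ∈ M.cells) (hg : g ⊆ T) (hg' : g ⊆ T') (i : Fin M.n) :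
    M.surfGrad T g i = M.surfGrad T' g i := by
  have hmem : M.surfGrad T g i - M.surfGrad T' g i ∈ M.tangent g :=
    Submodule.sub_mem _ (surfGrad_mem _ _ _) (surfGrad_mem _ _ _)
  have h : inner ℝ (M.surfGrad T g i - M.surfGrad T' g i)
      (M.surfGrad T g i - M.surfGrad T' g i) = 0 := by
    rw [inner_sub_left, inner_surfGrad _ _ _ hmem, inner_surfGrad _ _ _ hmem,
      inner_gradBary_congr hT hT' hg hg' i hmem, sub_self]
  exact sub_eq_zero.1 (inner_self_eq_zero.1 h)

/-- `∇_g λ_i ≠ 0` if `i` is a vertex of `g` and `g` has another vertex. -/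
theorem inner_surfGrad_self_ne_zero {T g : Finset (Fin M.n)} (hT : T ∈ M.cells) (hg : g ⊆ T)
    {i a : Fin M.n} (hi : i ∈ g) (ha : a ∈ g) (hia : i ≠ a) :
    inner ℝ (M.gradBary T i) (M.surfGrad T g i) ≠ 0 := by
  rw [← inner_surfGrad _ _ _ (surfGrad_mem T g i)]
  intro h
  have h0 := inner_self_eq_zero.1 h
  have h1 := inner_surfGrad T g i (sub_mem_tangent hi ha)
  rw [h0, inner_gradBary_sub hT i (hg hi) (hg ha), inner_zero_left] at h1
  simp [hia] at h1

/-- Modulo the tangent space of `e`, the surface gradient is a multiple `c` of the edge vector. The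
multiple is not zero: otherwise the surface gradient would be tangent to `e`, hence orthogonal to
`∇λ_m`, although its product with `∇λ_m` is its own squared length. -/
theorem vert_sub_mem_of_tangent_le {T e : Finset (Fin M.n)} (hT : T ∈ M.cells) {m m₀ : Fin M.n}
    (he : e ∪ {m} ⊆ T) (hm₀ : m₀ ∈ e) (hm : m ∉ e) {S : Submodule ℝ (E d)}
    (hS : M.tangent e ≤ S) (hw : M.surfGrad T (e ∪ {m}) m ∈ S) :
    M.vert m - M.vert m₀ ∈ S := by
  set w := M.surfGrad T (e ∪ {m}) m with hwdef
  have hle : M.tangent (e ∪ {m}) ≤ M.tangent e ⊔ Submodule.span ℝ {M.vert m - M.vert m₀} := by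
    refine tangent_le (m₀ := m₀) (by simp [hm₀]) fun a ha => ?_
    rcases Finset.mem_union.1 ha with h | h
    · exact Submodule.mem_sup_left (sub_mem_tangent h hm₀)
    · rw [Finset.mem_singleton.1 h]
      exact Submodule.mem_sup_right (Submodule.mem_span_singleton_self _)
  obtain ⟨a, ha, b, hb, hab⟩ := Submodule.mem_sup.1 (hle (surfGrad_mem T (e ∪ {m}) m))
  obtain ⟨c, rfl⟩ := Submodule.mem_span_singleton.1 hb
  have hc : c ≠ 0 := by
    rintro rfl
    rw [zero_smul, add_zero] at hab
    refine inner_surfGrad_self_ne_zero hT he (i := m) (a := m₀) (by simp) (by simp [hm₀])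
      (fun h => hm (h ▸ hm₀)) ?_
    rw [← hab]
    exact inner_gradBary_eq_zero hT (Finset.subset_union_left.trans he) hm ha
  have : M.vert m - M.vert m₀ = c⁻¹ • (w - a) := by
    rw [hwdef, ← hab, add_sub_cancel_left, smul_smul, inv_mul_cancel₀ hc, one_smul]
  rw [this]
  exact S.smul_mem _ (S.sub_mem hw (hS ha))

end Mesh

/-! ### Affine functions as polynomials -/

/-- An affine function as a polynomial in the Cartesian coordinates. -/
def affinePoly {d : ℕ} (F : E d →ᵃ[ℝ] ℝ) : MvPolynomial (Fin d) ℝ :=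
  ∑ j, MvPolynomial.C (F.linear (EuclideanSpace.basisFun (Fin d) ℝ j)) * MvPolynomial.X j +
    MvPolynomial.C (F 0)

theorem polyEval_affinePoly {d : ℕ} (F : E d →ᵃ[ℝ] ℝ) (x : E d) :
    polyEval (affinePoly F) x = F x := by
  have h : F x = F.linear x + F 0 := by
    have := F.map_vadd 0 x
    simpa using this
  rw [h]
  conv_rhs => rw [← (EuclideanSpace.basisFun (Fin d) ℝ).sum_repr x]
  simp [polyEval, affinePoly, mul_comm]

theorem totalDegree_affinePoly_le {d : ℕ} (F : E d →ᵃ[ℝ] ℝ) :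
    (affinePoly F).totalDegree ≤ 1 := by
  refine (MvPolynomial.totalDegree_add _ _).trans (max_le ?_ (by simp))
  refine MvPolynomial.totalDegree_finsetSum_le fun j _ => ?_
  refine (MvPolynomial.totalDegree_mul _ _).trans ?_
  simp

@[simp] theorem polyEval_C {d : ℕ} (c : ℝ) (x : E d) : polyEval (MvPolynomial.C c) x = c := by
  simp [polyEval]

@[simp] theorem polyEval_mul {d : ℕ} (p q : MvPolynomial (Fin d) ℝ) (x : E d) :
    polyEval (p * q) x = polyEval p x * polyEval q x := by
  simp [polyEval]

@[simp] theorem polyEval_sub {d : ℕ} (p q : MvPolynomial (Fin d) ℝ) (x : E d) :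
    polyEval (p - q) x = polyEval p x - polyEval q x := by
  simp [polyEval]

@[simp] theorem polyEval_sum {d : ℕ} {ι : Type*} (s : Finset ι)
    (p : ι → MvPolynomial (Fin d) ℝ) (x : E d) :
    polyEval (∑ i ∈ s, p i) x = ∑ i ∈ s, polyEval (p i) x := by
  simp [polyEval]

@[simp] theorem polyEval_prod {d : ℕ} {ι : Type*} (s : Finset ι)
    (p : ι → MvPolynomial (Fin d) ℝ) (x : E d) :
    polyEval (∏ i ∈ s, p i) x = ∏ i ∈ s, polyEval (p i) x := by
  simp [polyEval]

theorem totalDegree_sub_C_le {d : ℕ} {p : MvPolynomial (Fin d) ℝ} (hp : p.totalDegree ≤ 1)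
    (c : ℝ) : (p - MvPolynomial.C c).totalDegree ≤ 1 :=
  (MvPolynomial.totalDegree_sub _ _).trans (by simpa using hp)

theorem totalDegree_C_mul_le {d : ℕ} (c : ℝ) (p : MvPolynomial (Fin d) ℝ) :
    (MvPolynomial.C c * p).totalDegree ≤ p.totalDegree :=
  (MvPolynomial.totalDegree_mul _ _).trans (by simp)

namespace Mesh

variable {d : ℕ} {M : Mesh d}

/-! ### Lagrange interpolation -/

/-- The factors `r λ_m - j` of the Lagrange basis functions. -/
def baryFactor (M : Mesh d) (T : Finset (Fin M.n)) (r : ℕ) (m : Fin M.n) (j : ℕ) :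
    MvPolynomial (Fin d) ℝ :=
  MvPolynomial.C (r : ℝ) * affinePoly (M.bary T m) - MvPolynomial.C (j : ℝ)

theorem polyEval_baryFactor (T : Finset (Fin M.n)) (r : ℕ) (m : Fin M.n) (j : ℕ) (x : E d) :
    polyEval (M.baryFactor T r m j) x = r * M.bary T m x - j := by
  rw [baryFactor, polyEval_sub, polyEval_mul, polyEval_C, polyEval_C, polyEval_affinePoly]

theorem totalDegree_baryFactor_le (T : Finset (Fin M.n)) (r : ℕ) (m : Fin M.n) (j : ℕ) :
    (M.baryFactor T r m j).totalDegree ≤ 1 :=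
  totalDegree_sub_C_le ((totalDegree_C_mul_le _ _).trans (totalDegree_affinePoly_le _)) _

theorem totalDegree_prod_baryFactor_le (T : Finset (Fin M.n)) (r : ℕ) (m : Fin M.n) (a : ℕ)
    (g : ℕ → ℕ) : (∏ j ∈ Finset.range a, M.baryFactor T r m (g j)).totalDegree ≤ a := by
  refine (MvPolynomial.totalDegree_finsetProd _ _).trans ?_
  refine (Finset.sum_le_sum fun j _ => totalDegree_baryFactor_le T r m (g j)).trans ?_
  simp

/-- The Lagrange basis functions as polynomials. -/
def lagrangePoly (M : Mesh d) (r : ℕ) (α : Fin M.n → ℕ) (T : Finset (Fin M.n)) :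
    MvPolynomial (Fin d) ℝ :=
  MvPolynomial.C (1 / ((∏ m, (α m).factorial : ℕ) : ℝ)) *
    ∏ m, ∏ j ∈ Finset.range (α m), M.baryFactor T r m j

theorem polyEval_lagrangePoly (r : ℕ) (α : Fin M.n → ℕ) (T : Finset (Fin M.n)) (x : E d) :
    polyEval (M.lagrangePoly r α T) x = M.lagrange r α T x := by
  simp only [lagrangePoly, polyEval_mul, polyEval_prod, polyEval_C, polyEval_baryFactor, lagrange]

theorem totalDegree_lagrangePoly_le {r : ℕ} {α : Fin M.n → ℕ} (hα : ∑ m, α m = r)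
    (T : Finset (Fin M.n)) : (M.lagrangePoly r α T).totalDegree ≤ r := by
  refine (totalDegree_C_mul_le _ _).trans ((MvPolynomial.totalDegree_finsetProd _ _).trans ?_)
  refine (Finset.sum_le_sum fun m _ => ?_).trans hα.le
  exact totalDegree_prod_baryFactor_le T r m (α m) fun j => j

theorem mem_piAntidiag_of_support {α : Fin M.n → ℕ} {e T : Finset (Fin M.n)} {r : ℕ}
    (hα : ∑ m, α m = r) (he : ∀ m, α m ≠ 0 → m ∈ e) (heT : e ⊆ T) :
    α ∈ T.piAntidiag r := by
  refine Finset.mem_piAntidiag.2 ⟨?_, fun m hm => heT (he m hm)⟩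
  rw [← hα]
  exact Finset.sum_subset (Finset.subset_univ _) fun m _ hm => by
    by_contra h
    exact hm (heT (he m h))

theorem sum_eq_of_mem_piAntidiag {α : Fin M.n → ℕ} {T : Finset (Fin M.n)} {r : ℕ}
    (hα : α ∈ T.piAntidiag r) : ∑ m, α m = r := by
  obtain ⟨h1, h2⟩ := Finset.mem_piAntidiag.1 hα
  rw [← h1]
  exact (Finset.sum_subset (Finset.subset_univ _) fun m _ hm => by
    by_contra h
    exact hm (h2 m h)).symm

/-- The barycentric coordinates of the lattice points. -/
theorem bary_latticePoint {T : Finset (Fin M.n)} (hT : T ∈ M.cells) {r : ℕ} (hr : 1 ≤ r)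
    {β : Fin M.n → ℕ} (hβ : β ∈ T.piAntidiag r) (m : Fin M.n) :
    M.bary T m (M.latticePoint r β) = β m / r := by
  obtain ⟨h1, h2⟩ := Finset.mem_piAntidiag.1 hβ
  have hr0 : (r : ℝ) ≠ 0 := by positivity
  have hx : M.latticePoint r β = ∑ m ∈ T, ((β m : ℝ) / r) • M.vert m := by
    unfold latticePoint
    rw [Finset.smul_sum, ← Finset.sum_subset (Finset.subset_univ T)]
    · exact Finset.sum_congr rfl fun m _ => by rw [smul_smul]; congr 1; ring
    · intro m _ hm
      have : β m = 0 := by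
        by_contra h
        exact hm (h2 m h)
      simp [this]
  have hw : ∑ m ∈ T, ((β m : ℝ) / r) = 1 := by
    rw [← Finset.sum_div, ← Nat.cast_sum, h1, div_self hr0]
  rw [hx, bary_sum_smul_vert hT m hw]
  split_ifs with h
  · rfl
  · have : β m = 0 := by
      by_contra h'
      exact h (h2 m h')
    simp [this]

theorem lagrange_latticePoint {T : Finset (Fin M.n)} (hT : T ∈ M.cells) {r : ℕ} (hr : 1 ≤ r)
    {α β : Fin M.n → ℕ} (hα : ∑ m, α m = r) (hβ : β ∈ T.piAntidiag r) :
    M.lagrange r α T (M.latticePoint r β) = if α = β then 1 else 0 := by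
  have hr0 : (r : ℝ) ≠ 0 := by positivity
  have key : ∀ m, ∏ j ∈ Finset.range (α m),
      ((r : ℝ) * M.bary T m (M.latticePoint r β) - (j : ℝ)) = ((β m).descFactorial (α m) : ℕ) := by
    intro m
    rw [Nat.descFactorial_eq_prod_range, bary_latticePoint hT hr hβ, mul_div_cancel₀ _ hr0,
      Nat.cast_prod]
    by_cases h : α m ≤ β m
    · refine Finset.prod_congr rfl fun j hj => ?_
      rw [Nat.cast_sub ((Finset.mem_range.1 hj).le.trans h)]
    -- The cast of a truncated difference is not the real difference here, but both products contain
    -- the vanishing factor `j = β_m`.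
    · push Not at h
      rw [Finset.prod_eq_zero (Finset.mem_range.2 h) (sub_self _),
        Finset.prod_eq_zero (Finset.mem_range.2 h) (by simp)]
  unfold lagrange
  rw [Finset.prod_congr rfl fun m _ => key m]
  split_ifs with h
  · subst h
    simp only [Nat.descFactorial_self, Nat.cast_prod]
    exact one_div_mul_cancel (Finset.prod_ne_zero_iff.2 fun m _ => by positivity)
  · have : ∃ m, β m < α m := by
      by_contra! hc
      refine h (funext fun m => ?_)
      have hs : ∑ m, α m = ∑ m, β m := by rw [hα, sum_eq_of_mem_piAntidiag hβ]
      exact (Finset.sum_eq_sum_iff_of_le fun m _ => hc m).1 hs m (Finset.mem_univ m)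
    obtain ⟨m, hm⟩ := this
    refine mul_eq_zero_of_right _ (Finset.prod_eq_zero (Finset.mem_univ m) ?_)
    rw [Nat.descFactorial_of_lt hm, Nat.cast_zero]

/-- Monomials of degree at most `r` are not more numerous than the lattice points of degree `r` of
a simplex. -/
theorem finrank_restrictTotalDegree_le {T : Finset (Fin M.n)} (hT : T ∈ M.cells) (r : ℕ) :
    Module.finrank ℝ (MvPolynomial.restrictTotalDegree (Fin d) ℝ r) ≤ (T.piAntidiag r).card := by
  rw [MvPolynomial.restrictTotalDegree,
    Module.finrank_eq_nat_card_basis (MvPolynomial.basisRestrictSupport ℝ _),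
    ← Nat.card_eq_card_toFinset (T.piAntidiag r : Set (Fin M.n → ℕ)) |>.trans
      (by simp : _ = (T.piAntidiag r).card)]
  let ε : T ≃ Fin (d + 1) := T.equivFinOfCardEq (M.card_cell T hT)
  -- Homogenization: the slack `r - |n|` goes to the first vertex, the exponents to the other `d`.
  let F : (Fin d →₀ ℕ) → Fin M.n → ℕ := fun n m =>
    if h : m ∈ T then Fin.cons (α := fun _ => ℕ) (r - n.sum fun _ e => e) (n : Fin d → ℕ)
      (ε ⟨m, h⟩) else 0
  have hF : ∀ n m (h : m ∈ T), F n m =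
      Fin.cons (α := fun _ => ℕ) (r - n.sum fun _ e => e) (n : Fin d → ℕ) (ε ⟨m, h⟩) :=
    fun n m h => dif_pos h
  have hmem : ∀ n : {n : Fin d →₀ ℕ | (n.sum fun _ e => e) ≤ r}, F n ∈ T.piAntidiag r := by
    rintro ⟨n, hn⟩
    refine Finset.mem_piAntidiag.2 ⟨?_, fun m hm => ?_⟩
    · rw [← Finset.sum_coe_sort,
        Finset.sum_congr rfl (fun (m : T) _ => hF n m m.2),
        Equiv.sum_comp ε (Fin.cons (α := fun _ => ℕ) (r - n.sum fun _ e => e) (n : Fin d → ℕ)),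
        Fin.sum_univ_succ]
      have : n.sum (fun _ e => e) = ∑ i, n i := Finsupp.sum_fintype _ _ fun _ => rfl
      simp only [Fin.cons_zero, Fin.cons_succ]
      rw [← this]
      exact Nat.sub_add_cancel hn
    · by_contra h
      exact hm (dif_neg h)
  refine Nat.card_le_card_of_injective
    (fun n => (⟨F n, hmem n⟩ : (T.piAntidiag r : Set (Fin M.n → ℕ)))) ?_
  intro n n' hnn
  have h : F n = F n' := congrArg Subtype.val hnn
  refine Subtype.ext (Finsupp.ext fun j => ?_)
  have h1 := congrFun h (ε.symm j.succ).1
  rw [hF _ _ (ε.symm j.succ).2, hF _ _ (ε.symm j.succ).2] at h1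
  simpa using h1

/-- Evaluation at the lattice points is onto, since the Lagrange functions realize every set of
values. The count of monomials leaves no room for a kernel. -/
theorem eq_zero_of_polyEval_latticePoint {T : Finset (Fin M.n)} (hT : T ∈ M.cells) {r : ℕ}
    (hr : 1 ≤ r) {p : MvPolynomial (Fin d) ℝ} (hp : p.totalDegree ≤ r)
    (h : ∀ α ∈ T.piAntidiag r, polyEval p (M.latticePoint r α) = 0) : p = 0 := by
  let V := MvPolynomial.restrictTotalDegree (Fin d) ℝ r
  let ev : V →ₗ[ℝ] (T.piAntidiag r → ℝ) :=
    { toFun := fun p α => polyEval p.1 (M.latticePoint r α.1)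
      map_add' := fun p q => by ext; simp [polyEval]
      map_smul' := fun c p => by ext; simp [polyEval] }
  have hsurj : Function.Surjective ev := by
    intro c
    have hmem : ∑ α : T.piAntidiag r, MvPolynomial.C (c α) * M.lagrangePoly r α.1 T ∈ V := by
      refine Submodule.sum_mem _ fun α _ => ?_
      rw [MvPolynomial.mem_restrictTotalDegree]
      exact (totalDegree_C_mul_le _ _).trans
        (totalDegree_lagrangePoly_le (sum_eq_of_mem_piAntidiag α.2) T)
    refine ⟨⟨_, hmem⟩, funext fun β => ?_⟩
    change polyEval (∑ α : T.piAntidiag r, MvPolynomial.C (c α) * M.lagrangePoly r α.1 T) _ = _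
    rw [polyEval_sum, Finset.sum_eq_single β]
    · rw [polyEval_mul, polyEval_C, polyEval_lagrangePoly,
        lagrange_latticePoint hT hr (sum_eq_of_mem_piAntidiag β.2) β.2, if_pos rfl, mul_one]
    · intro α _ hα
      rw [polyEval_mul, polyEval_C, polyEval_lagrangePoly,
        lagrange_latticePoint hT hr (sum_eq_of_mem_piAntidiag α.2) β.2,
        if_neg fun e => hα (Subtype.ext e), mul_zero]
    · exact fun h => absurd (Finset.mem_univ _) h
  have hfin : Module.finrank ℝ V = Module.finrank ℝ (T.piAntidiag r → ℝ) := by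
    refine le_antisymm ?_ (LinearMap.finrank_le_finrank_of_surjective hsurj)
    simpa using finrank_restrictTotalDegree_le hT r
  have hinj := (LinearMap.injective_iff_surjective_of_finrank_eq_finrank hfin).2 hsurj
  have hpV : p ∈ V := (MvPolynomial.mem_restrictTotalDegree _ _ _).2 hp
  have : (⟨p, hpV⟩ : V) = 0 := by
    refine hinj ?_
    rw [map_zero]
    exact funext fun α => h α.1 α.2
  exact congrArg Subtype.val this

theorem polyEval_eq_sum_lagrange {T : Finset (Fin M.n)} (hT : T ∈ M.cells) {r : ℕ}
    (hr : 1 ≤ r) {p : MvPolynomial (Fin d) ℝ} (hp : p.totalDegree ≤ r) (x : E d) :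
    polyEval p x =
      ∑ α ∈ T.piAntidiag r, M.lagrange r α T x * polyEval p (M.latticePoint r α) := by
  set q : MvPolynomial (Fin d) ℝ := ∑ α ∈ T.piAntidiag r,
    MvPolynomial.C (polyEval p (M.latticePoint r α)) * M.lagrangePoly r α T with hq
  have hqe : ∀ y, polyEval q y =
      ∑ α ∈ T.piAntidiag r, M.lagrange r α T y * polyEval p (M.latticePoint r α) := by
    intro y
    rw [hq, polyEval_sum]
    exact Finset.sum_congr rfl fun α _ => by
      rw [polyEval_mul, polyEval_C, polyEval_lagrangePoly, mul_comm]
  have hqd : q.totalDegree ≤ r := MvPolynomial.totalDegree_finsetSum_le fun α hα =>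
    (totalDegree_C_mul_le _ _).trans
      (totalDegree_lagrangePoly_le (sum_eq_of_mem_piAntidiag hα) T)
  have h0 : p - q = 0 := by
    refine eq_zero_of_polyEval_latticePoint hT hr
      ((MvPolynomial.totalDegree_sub _ _).trans (max_le hp hqd)) fun β hβ => ?_
    rw [polyEval_sub, hqe, Finset.sum_eq_single β]
    · rw [lagrange_latticePoint hT hr (sum_eq_of_mem_piAntidiag hβ) hβ, if_pos rfl, one_mul,
        sub_self]
    · intro α hα hαβ
      rw [lagrange_latticePoint hT hr (sum_eq_of_mem_piAntidiag hα) hβ, if_neg hαβ, zero_mul]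
    · exact fun h => absurd hβ h
  rw [← hqe, ← sub_eq_zero, ← polyEval_sub, h0]
  simp [polyEval]

/-- Lagrange interpolation of polynomial forms. -/
theorem polyForms_eq_sum_lagrange {T : Finset (Fin M.n)} (hT : T ∈ M.cells) {k r : ℕ}
    (hr : 1 ≤ r) {p : E d → Alt d k} (hp : p ∈ polyForms d k r) (x : E d) :
    p x = ∑ α ∈ T.piAntidiag r, M.lagrange r α T x • p (M.latticePoint r α) := by
  induction hp using Submodule.span_induction generalizing x with
  | mem p hp =>
    obtain ⟨q, a, hq, rfl⟩ := hp
    simp only [smul_smul, ← Finset.sum_smul]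
    rw [← polyEval_eq_sum_lagrange hT hr hq]
  | zero => simp
  | add p q _ _ hp hq =>
    simp only [Pi.add_apply, smul_add, Finset.sum_add_distrib]
    rw [← hp, ← hq]
  | smul c p _ hp =>
    simp only [Pi.smul_apply, smul_comm _ c]
    rw [← Finset.smul_sum, ← hp]

theorem polyForms_eq_of_latticePoint {T : Finset (Fin M.n)} (hT : T ∈ M.cells) {k r : ℕ}
    (hr : 1 ≤ r) {p q : E d → Alt d k} (hp : p ∈ polyForms d k r) (hq : q ∈ polyForms d k r)
    (h : ∀ α ∈ T.piAntidiag r, p (M.latticePoint r α) = q (M.latticePoint r α)) : p = q := by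
  funext x
  rw [polyForms_eq_sum_lagrange hT hr hp, polyForms_eq_sum_lagrange hT hr hq]
  exact Finset.sum_congr rfl fun α hα => by rw [h α hα]

theorem lagrange_smul_mem_polyForms {k r : ℕ} {α : Fin M.n → ℕ} (hα : ∑ m, α m = r)
    (T : Finset (Fin M.n)) (a : Alt d k) :
    (fun x => M.lagrange r α T x • a) ∈ polyForms d k r :=
  Submodule.subset_span ⟨M.lagrangePoly r α T, a, totalDegree_lagrangePoly_le hα T,
    funext fun x => by rw [polyEval_lagrangePoly]⟩

/-- On a sub-simplex that does not contain the support of `α` the function `φ_α` vanishes. -/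
theorem lagrange_eq_zero {T : Finset (Fin M.n)} {r : ℕ} {α : Fin M.n → ℕ} {m : Fin M.n}
    (hm : α m ≠ 0) {x : E d} (hx : M.bary T m x = 0) : M.lagrange r α T x = 0 := by
  unfold lagrange
  refine mul_eq_zero_of_right _ (Finset.prod_eq_zero (Finset.mem_univ m) ?_)
  exact Finset.prod_eq_zero (Finset.mem_range.2 (Nat.pos_of_ne_zero hm)) (by simp [hx])

/-- `φ_α` is divisible by the bubble polynomial of the support of `α`. -/
theorem exists_lagrange_eq_bubble_mul {T e : Finset (Fin M.n)} {r : ℕ} {α : Fin M.n → ℕ}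
    (hα : ∑ m, α m = r) (he : ∀ m, α m ≠ 0 ↔ m ∈ e) :
    ∃ q : MvPolynomial (Fin d) ℝ, q.totalDegree + e.card ≤ r ∧
      ∀ x, M.lagrange r α T x = (∏ m ∈ e, M.bary T m x) * polyEval q x := by
  have hsplit : ∀ m ∈ e, α m - 1 + 1 = α m := fun m hm =>
    Nat.sub_add_cancel (Nat.one_le_iff_ne_zero.2 ((he m).2 hm))
  have hcompl : ∀ m, m ∉ e → α m = 0 := fun m hm => by
    by_contra h
    exact hm ((he m).1 h)
  -- For each `m ∈ e` the factor `j = 0` is `r λ_m`. Pulling these out leaves the factors with `j`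
  -- shifted by one, of total degree `∑ (α_m - 1) = r - |e|`.
  refine ⟨MvPolynomial.C (1 / ((∏ m, (α m).factorial : ℕ) : ℝ) * ∏ m ∈ e, (r : ℝ)) *
    ∏ m ∈ e, ∏ j ∈ Finset.range (α m - 1), M.baryFactor T r m (j + 1), ?_, fun x => ?_⟩
  · have h1 : ∑ m ∈ e, (α m - 1) + e.card = r := by
      rw [Finset.card_eq_sum_ones, ← Finset.sum_add_distrib, Finset.sum_congr rfl hsplit, ← hα]
      exact Finset.sum_subset (Finset.subset_univ _) fun m _ hm => hcompl m hm
    have h2 : (MvPolynomial.C (1 / ((∏ m, (α m).factorial : ℕ) : ℝ) * ∏ m ∈ e, (r : ℝ)) *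
        ∏ m ∈ e, ∏ j ∈ Finset.range (α m - 1), M.baryFactor T r m (j + 1)).totalDegree ≤
          ∑ m ∈ e, (α m - 1) := by
      refine (totalDegree_C_mul_le _ _).trans ((MvPolynomial.totalDegree_finsetProd _ _).trans ?_)
      exact Finset.sum_le_sum fun m _ => totalDegree_prod_baryFactor_le T r m _ _
    omega
  · unfold lagrange
    have h4 : ∏ m, ∏ j ∈ Finset.range (α m), ((r : ℝ) * M.bary T m x - (j : ℝ)) =
        ∏ m ∈ e, ∏ j ∈ Finset.range (α m), ((r : ℝ) * M.bary T m x - (j : ℝ)) :=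
      (Finset.prod_subset (Finset.subset_univ e)
        (fun m _ hm => by rw [hcompl m hm, Finset.prod_range_zero])).symm
    rw [h4]
    have h3 : ∀ m ∈ e, ∏ j ∈ Finset.range (α m), ((r : ℝ) * M.bary T m x - (j : ℝ)) =
        (r : ℝ) * M.bary T m x *
          ∏ j ∈ Finset.range (α m - 1), polyEval (M.baryFactor T r m (j + 1)) x := by
      intro m hm
      conv_lhs => rw [← hsplit m hm, Finset.prod_range_succ']
      simp [polyEval_baryFactor, mul_comm]
    rw [Finset.prod_congr rfl h3, Finset.prod_mul_distrib, Finset.prod_mul_distrib]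
    simp only [polyEval_mul, polyEval_C, polyEval_prod]
    ring

end Mesh

namespace Mesh

variable {d : ℕ} {M : Mesh d}

/-! ### Restrictions to simplices -/

theorem continuous_bary (T : Finset (Fin M.n)) (m : Fin M.n) : Continuous (M.bary T m) :=
  (M.bary T m).continuous_of_finiteDimensional

theorem latticePoint_mem_simplex {T e : Finset (Fin M.n)} (hT : T ∈ M.cells) (he : e ⊆ T)
    {r : ℕ} (hr : 1 ≤ r) {α : Fin M.n → ℕ} (hα : ∑ m, α m = r) (hs : ∀ m, α m ≠ 0 → m ∈ e) :
    M.latticePoint r α ∈ M.simplex e := by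
  have hmem := mem_piAntidiag_of_support hα hs he
  rw [mem_simplex_iff hT he]
  refine ⟨fun m _ => ?_, fun m hm => ?_⟩
  · rw [bary_latticePoint hT hr hmem]
    positivity
  · have : α m = 0 := by
      by_contra h
      exact hm (hs m h)
    rw [bary_latticePoint hT hr hmem, this, Nat.cast_zero, zero_div]

theorem simplex_subset_closure_interior {T : Finset (Fin M.n)} (hT : T ∈ M.cells) :
    M.simplex T ⊆ closure (interior (M.simplex T)) := by
  have hrange : Set.range (M.cellBasis T hT) = M.vert '' (T : Set (Fin M.n)) := by
    ext x
    constructor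
    · rintro ⟨i, rfl⟩
      exact ⟨i, i.2, rfl⟩
    · rintro ⟨i, hi, rfl⟩
      exact ⟨⟨i, hi⟩, rfl⟩
  have hne : (interior (M.simplex T)).Nonempty := by
    unfold simplex
    rw [← hrange]
    exact ⟨_, (M.cellBasis T hT).centroid_mem_interior_convexHull⟩
  have hconv : Convex ℝ (M.simplex T) := convex_convexHull ℝ _
  rw [hconv.closure_interior_eq_closure_of_nonempty_interior hne]
  exact subset_closure

/-- Continuous representatives that agree almost everywhere agree on all of `T`, because `T` is in
the closure of its interior. The lattice points of `T` then determine the polynomial form on the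
whole of `ℝ^d`, so traces on sub-simplices are well defined. -/
theorem IsPiece.unique {k r : ℕ} (hr : 1 ≤ r) {ω : M.L2Forms k} {T : Finset (Fin M.n)}
    (hT : T ∈ M.cells) {p q : E d → Alt d k} (hp : M.IsPiece r ω T p) (hq : M.IsPiece r ω T q) :
    p = q := by
  have heq : Set.EqOn p q (M.simplex T) :=
    Measure.eqOn_of_ae_eq (hp.2.symm.trans hq.2) (continuous_of_mem_polyForms hp.1).continuousOn
      (continuous_of_mem_polyForms hq.1).continuousOn (simplex_subset_closure_interior hT)
  exact polyForms_eq_of_latticePoint hT hr hp.1 hq.1 fun α hα =>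
    heq (latticePoint_mem_simplex hT subset_rfl hr (sum_eq_of_mem_piAntidiag hα)
      (Finset.mem_piAntidiag.1 hα).2)

theorem IsPiece.piece_eq {k r : ℕ} (hr : 1 ≤ r) {ω : M.L2Forms k} {T : Finset (Fin M.n)}
    (hT : T ∈ M.cells) {p : E d → Alt d k} (hp : M.IsPiece r ω T p) : M.piece r ω T = p := by
  have h : ∃ p, M.IsPiece r ω T p := ⟨p, hp⟩
  unfold piece
  rw [dif_pos h]
  exact h.choose_spec.unique hr hT hp

theorem isPiece_piece {O : M.Orientation} {k r : ℕ} {ω : M.L2Forms k}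
    (hω : ω ∈ M.feSpace O k r) {T : Finset (Fin M.n)} (hT : T ∈ M.cells) :
    M.IsPiece r ω T (M.piece r ω T) := by
  obtain ⟨p, hp, -⟩ := hω
  have h : ∃ p, M.IsPiece r ω T p := ⟨p T, hp T hT⟩
  unfold piece
  rw [dif_pos h]
  exact h.choose_spec

theorem IsPiece.add {k r : ℕ} {ω ω' : M.L2Forms k} {T : Finset (Fin M.n)} (hT : T ∈ M.cells)
    {p p' : E d → Alt d k} (hp : M.IsPiece r ω T p) (hp' : M.IsPiece r ω' T p') :
    M.IsPiece r (ω + ω') T (p + p') := by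
  have h : ⇑(ω + ω') =ᵐ[volume.restrict (M.simplex T)] ⇑ω + ⇑ω' :=
    ae_mono (Measure.restrict_mono (simplex_subset_domain hT) le_rfl) (Lp.coeFn_add ω ω')
  exact ⟨Submodule.add_mem _ hp.1 hp'.1, h.trans (hp.2.add hp'.2)⟩

theorem IsPiece.smul {k r : ℕ} {ω : M.L2Forms k} {T : Finset (Fin M.n)} (hT : T ∈ M.cells)
    (c : ℝ) {p : E d → Alt d k} (hp : M.IsPiece r ω T p) : M.IsPiece r (c • ω) T (c • p) := by
  have h : ⇑(c • ω) =ᵐ[volume.restrict (M.simplex T)] c • ⇑ω :=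
    ae_mono (Measure.restrict_mono (simplex_subset_domain hT) le_rfl) (Lp.coeFn_smul c ω)
  exact ⟨Submodule.smul_mem _ c hp.1, h.trans (hp.2.const_smul c)⟩

theorem eq_of_ae_eq_on_cells {k : ℕ} {ω ω' : M.L2Forms k}
    (h : ∀ T ∈ M.cells, ω =ᵐ[volume.restrict (M.simplex T)] ω') : ω = ω' := by
  refine Lp.ext ?_
  unfold Mesh.domain
  exact (ae_restrict_biUnion_iff _ M.cells.countable_toSet _).2 h

/-- The single-valuedness of the moments of the pieces. -/
theorem moment_piece_eq {O : M.Orientation} {k r : ℕ} (hr : 1 ≤ r) {ω : M.L2Forms k}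
    (hω : ω ∈ M.feSpace O k r) (i : M.FormIndex k) (hi : i.f.card ≤ d)
    {T T' : Finset (Fin M.n)} (hT : T ∈ M.cells) (hT' : T' ∈ M.cells) (hf : i.f ⊆ T)
    (hf' : i.f ⊆ T') (q : MvPolynomial (Fin d) ℝ) (hq : q.totalDegree + i.e.card ≤ r) :
    i.moment O T q (M.piece r ω T) = i.moment O T' q (M.piece r ω T') := by
  obtain ⟨p, hp, hs⟩ := hω
  rw [(hp T hT).piece_eq hr hT, (hp T' hT').piece_eq hr hT']
  exact hs i hi T hT T' hT' hf hf' q hq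

/-! ### The surface measure -/

theorem finrank_tangent {T e : Finset (Fin M.n)} (hT : T ∈ M.cells) (he : e ⊆ T)
    (hne : e.Nonempty) : Module.finrank ℝ (M.tangent e) = e.card - 1 := by
  have hind : AffineIndependent ℝ (fun i : e => M.vert i) :=
    (M.affineIndependent_cell T hT).comp_embedding
      ⟨fun i : e => (⟨i, he i.2⟩ : T), fun i j h => Subtype.ext (congrArg (fun x : T => x.1) h)⟩
  have hrange : M.vert '' (e : Set (Fin M.n)) = Set.range (fun i : e => M.vert i) := by
    ext x
    simp
  unfold tangent
  rw [hrange]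
  refine hind.finrank_vectorSpan ?_
  rw [Fintype.card_coe, Nat.sub_add_cancel hne.card_pos]

/-- A continuous nonnegative function on a simplex with integral zero vanishes at the points of
the relative interior. -/
theorem eq_zero_of_setIntegral_simplex_eq_zero {T e : Finset (Fin M.n)} (hT : T ∈ M.cells)
    (he : e ⊆ T) (hne : e.Nonempty) {g : E d → ℝ} (hg : Continuous g)
    (hg0 : ∀ y ∈ M.simplex e, 0 ≤ g y)
    (hint : ∫ y in M.simplex e, g y ∂(Measure.euclideanHausdorffMeasure (e.card - 1)) = 0)
    {x : E d} (hx : ∀ m ∈ e, 0 < M.bary T m x) (hx0 : ∀ m, m ∉ e → M.bary T m x = 0) :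
    g x = 0 := by
  by_contra hgx
  have hxe : x ∈ M.simplex e := (mem_simplex_iff hT he x).2 ⟨fun m hm => (hx m hm).le, hx0⟩
  have hpos : 0 < g x := lt_of_le_of_ne (hg0 x hxe) (Ne.symm hgx)
  set μ : Measure (E d) := Measure.euclideanHausdorffMeasure (e.card - 1) with hμ
  have hmeas : MeasurableSet (M.simplex e) := (isCompact_simplex e).measurableSet
  have hintg : IntegrableOn g (M.simplex e) μ := by
    obtain ⟨C, hC⟩ := (isCompact_simplex e).exists_bound_of_continuousOn hg.continuousOn
    exact Measure.integrableOn_of_bounded (measure_simplex_lt_top e).ne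
      hg.aestronglyMeasurable ((ae_restrict_iff' hmeas).2 (Filter.Eventually.of_forall hC))
  have hae : g =ᵐ[μ.restrict (M.simplex e)] 0 :=
    (setIntegral_eq_zero_iff_of_nonneg_ae
      ((ae_restrict_iff' hmeas).2 (Filter.Eventually.of_forall hg0)) hintg).1 hint
  have hnull : μ ({y | 0 < g y} ∩ M.simplex e) = 0 := by
    have h1 : μ.restrict (M.simplex e) {y | ¬ g y = (0 : E d → ℝ) y} = 0 := ae_iff.1 hae
    rw [Measure.restrict_apply' hmeas] at h1
    refine measure_mono_null ?_ h1
    rintro y ⟨hy, hye⟩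
    exact ⟨ne_of_gt hy, hye⟩
  -- The tangent space of `e` parametrizes the affine hull isometrically, so the surface measure
  -- pulls back to a Haar measure, which charges nonempty open sets. The set `W` below maps into
  -- `e`: its defining conditions keep the coordinates of `e` positive, and the others stay zero
  -- because their gradients are normal to `e`.
  let ψ : M.tangent e → E d := fun v => x + v
  have hψ : Isometry ψ := (IsometryEquiv.addLeft x).isometry.comp isometry_subtype_coe
  let W : Set (M.tangent e) := ψ ⁻¹' ({y | 0 < g y} ∩ ⋂ m ∈ e, {y | 0 < M.bary T m y})
  have hW : IsOpen W := by
    refine IsOpen.preimage hψ.continuous ((isOpen_lt continuous_const hg).inter ?_)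
    exact isOpen_biInter_finset fun m _ => isOpen_lt continuous_const (continuous_bary T m)
  have h0 : (0 : M.tangent e) ∈ W := by
    simp only [W, ψ, Set.mem_preimage, Submodule.coe_zero, add_zero]
    exact ⟨hpos, Set.mem_iInter₂.2 hx⟩
  have hHaar : (Measure.euclideanHausdorffMeasure (e.card - 1) :
      Measure (M.tangent e)).IsAddHaarMeasure := by
    have := isAddHaarMeasure_euclideanHausdorffMeasure (E := M.tangent e)
    rwa [finrank_tangent hT he hne] at this
  have hWpos := hW.measure_pos
    (Measure.euclideanHausdorffMeasure (e.card - 1) : Measure (M.tangent e)) ⟨0, h0⟩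
  rw [← hψ.euclideanHausdorffMeasure_image] at hWpos
  refine hWpos.ne' (measure_mono_null ?_ hnull)
  rintro _ ⟨v, hv, rfl⟩
  refine ⟨hv.1, (mem_simplex_iff hT he _).2 ⟨fun m hm => (Set.mem_iInter₂.1 hv.2 m hm).le,
    fun m hm => ?_⟩⟩
  have h1 : M.bary T m (ψ v) = (M.bary T m).linear v + M.bary T m x := by
    have := (M.bary T m).map_vadd x (v : E d)
    simpa [ψ, add_comm] using this
  rw [h1, hx0 m hm, ← inner_gradBary, inner_gradBary_eq_zero hT he hm v.2, add_zero]

end Mesh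

theorem append_eq_sumElim {m n : ℕ} {β : Type*} (a : Fin m → β) (b : Fin n → β)
    (j : Fin (m + n)) : Fin.append a b j = Sum.elim a b (finSumFinEquiv.symm j) := by
  refine Fin.addCases (fun i => ?_) (fun i => ?_) j <;> simp

namespace Mesh

variable {d : ℕ} {M : Mesh d} {k : ℕ}

/-! ### The frames `t^e, ∇_{e ∪ m} λ_m` and `t^e, ∇λ_m` -/

/-- The vectors `t^e_a` and `∇_{e ∪ m} λ_m`. -/
def dofFrame (O : M.Orientation) (T e : Finset (Fin M.n)) : Fin (e.card - 1) ⊕ Fin M.n → E d :=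
  Sum.elim (O.tan e) fun m => M.surfGrad T (e ∪ {m}) m

/-- The vectors `t^e_a` and `∇λ_m`. -/
def shapeFrame (O : M.Orientation) (T e : Finset (Fin M.n)) : Fin (e.card - 1) ⊕ Fin M.n → E d :=
  Sum.elim (O.tan e) fun m => M.gradBary T m

/-- The labels of the frame vectors that occur in the forms with index `(e, f, σ)`. -/
def FormIndex.label (i : M.FormIndex k) (O : M.Orientation) :
    Fin k → Fin (i.e.card - 1) ⊕ Fin M.n :=
  Sum.map i.σ (fun b => (O.ord i.e i.f b).1) ∘ ((finCongr i.card_eq).trans finSumFinEquiv.symm)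

theorem FormIndex.label_injective (i : M.FormIndex k) (O : M.Orientation) :
    (i.label O).Injective :=
  (Sum.map_injective.2 ⟨i.σ.injective,
    Subtype.val_injective.comp (O.ord i.e i.f).injective⟩).comp (Equiv.injective _)

theorem FormIndex.range_label (i : M.FormIndex k) (O : M.Orientation) :
    Set.range (i.label O) = Set.range (Sum.map i.σ fun b => (O.ord i.e i.f b).1) :=
  EquivLike.range_comp _ _

theorem FormIndex.inl_mem_range_label (i : M.FormIndex k) (O : M.Orientation)
    (a : Fin (i.e.card - 1)) : Sum.inl a ∈ Set.range (i.label O) ↔ a ∈ Set.range i.σ := by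
  rw [i.range_label]
  simp

theorem FormIndex.inr_mem_range_label (i : M.FormIndex k) (O : M.Orientation) (m : Fin M.n) :
    Sum.inr m ∈ Set.range (i.label O) ↔ m ∈ i.f \ i.e := by
  rw [i.range_label]
  constructor
  · rintro ⟨a | b, h⟩
    · simp at h
    · simp only [Sum.map_inr, Sum.inr.injEq] at h
      rw [← h]
      exact (O.ord i.e i.f b).2
  · intro h
    exact ⟨Sum.inr ((O.ord i.e i.f).symm ⟨m, h⟩), by simp⟩

/-- The forms become wedges of members of one family depending only on `e`. Different `(f, σ)` are
then compared through their sets of labels. -/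
theorem FormIndex.tnForm_eq (i : M.FormIndex k) (O : M.Orientation) (w : Fin M.n → E d) :
    i.tnForm O (fun b => w (O.ord i.e i.f b).1) =
      wedgeFlat (Sum.elim (O.tan i.e) w ∘ i.label O) := by
  unfold FormIndex.tnForm
  congr 1
  funext j
  rw [append_eq_sumElim]
  simp only [FormIndex.label, Function.comp_apply, Equiv.trans_apply, finCongr_apply]
  generalize finSumFinEquiv.symm (Fin.cast i.card_eq j) = x
  rcases x with a | b <;> simp

theorem FormIndex.dofForm_eq (i : M.FormIndex k) (O : M.Orientation) (T : Finset (Fin M.n)) :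
    i.dofForm O T = wedgeFlat (dofFrame O T i.e ∘ i.label O) :=
  i.tnForm_eq O fun m => M.surfGrad T (i.e ∪ {m}) m

theorem FormIndex.shapeForm_eq (i : M.FormIndex k) (O : M.Orientation) (T : Finset (Fin M.n)) :
    i.shapeForm O T = wedgeFlat (shapeFrame O T i.e ∘ i.label O) :=
  i.tnForm_eq O fun m => M.gradBary T m

theorem FormIndex.altInner_dofForm (i : M.FormIndex k) (O : M.Orientation)
    (T : Finset (Fin M.n)) (η : Alt d k) :
    altInner η (i.dofForm O T) = η (dofFrame O T i.e ∘ i.label O) := by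
  rw [i.dofForm_eq, altInner_wedgeFlat]

theorem tan_mem_tangent (O : M.Orientation) {e : Finset (Fin M.n)} (he : M.IsFace e)
    (a : Fin (e.card - 1)) : O.tan e a ∈ M.tangent e := by
  rw [← O.span_tan e he]
  exact Submodule.subset_span ⟨a, rfl⟩

/-- This is why a degree of freedom sees only the tangential part of a form on `f`. -/
theorem FormIndex.dofFrame_label_mem (i : M.FormIndex k) (O : M.Orientation)
    (T : Finset (Fin M.n)) (j : Fin k) : dofFrame O T i.e (i.label O j) ∈ M.tangent i.f := by
  have hj : i.label O j ∈ Set.range (i.label O) := ⟨j, rfl⟩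
  revert hj
  generalize i.label O j = x
  rcases x with a | m
  · exact fun _ => tangent_mono i.e_subset (tan_mem_tangent O i.isFace_e a)
  · intro h
    rw [i.inr_mem_range_label] at h
    refine tangent_mono ?_ (surfGrad_mem T (i.e ∪ {m}) m)
    exact Finset.union_subset i.e_subset
      (Finset.singleton_subset_iff.2 (Finset.mem_sdiff.1 h).1)

/-- The degree of freedom forms do not depend on the simplex. -/
theorem FormIndex.dofFrame_label_congr (i : M.FormIndex k) (O : M.Orientation)
    {T T' : Finset (Fin M.n)} (hT : T ∈ M.cells) (hT' : T' ∈ M.cells) (hf : i.f ⊆ T)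
    (hf' : i.f ⊆ T') : dofFrame O T i.e ∘ i.label O = dofFrame O T' i.e ∘ i.label O := by
  funext j
  have hj : i.label O j ∈ Set.range (i.label O) := ⟨j, rfl⟩
  revert hj
  simp only [Function.comp_apply]
  generalize i.label O j = x
  rcases x with a | m
  · exact fun _ => rfl
  · intro h
    rw [i.inr_mem_range_label] at h
    have hsub : i.e ∪ {m} ⊆ i.f := Finset.union_subset i.e_subset
      (Finset.singleton_subset_iff.2 (Finset.mem_sdiff.1 h).1)
    exact surfGrad_congr hT hT' (hsub.trans hf) (hsub.trans hf') m

theorem FormIndex.dofForm_congr (i : M.FormIndex k) (O : M.Orientation)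
    {T T' : Finset (Fin M.n)} (hT : T ∈ M.cells) (hT' : T' ∈ M.cells) (hf : i.f ⊆ T)
    (hf' : i.f ⊆ T') : i.dofForm O T = i.dofForm O T' := by
  rw [i.dofForm_eq, i.dofForm_eq, i.dofFrame_label_congr O hT hT' hf hf']

/-- Every `k` distinct frame vectors are, up to their order, those of an index. -/
theorem exists_formIndex_range_label_eq (O : M.Orientation) {T e f : Finset (Fin M.n)}
    (hT : T ∈ M.cells) (hef : e ⊆ f) (hf : f ⊆ T) (hne : e.Nonempty)
    {ρ : Fin k → Fin (e.card - 1) ⊕ Fin M.n} (hρ : ρ.Injective)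
    (hρf : ∀ j m, ρ j = Sum.inr m → m ∈ f \ e) :
    ∃ (i : M.FormIndex k) (he : i.e = e), i.f ⊆ f ∧
      Set.range ρ = Set.range (he ▸ i.label O : Fin k → Fin (e.card - 1) ⊕ Fin M.n) := by
  classical
  set u := Finset.univ.image ρ with hu
  have hcard : u.card = k := by
    rw [hu, Finset.card_image_of_injective _ hρ, Finset.card_univ, Fintype.card_fin]
  have hsum : u.toLeft.card + u.toRight.card = k := by
    rw [Finset.card_toLeft_add_card_toRight, hcard]
  have hB : u.toRight ⊆ f \ e := by
    intro m hm
    obtain ⟨j, -, hj⟩ := Finset.mem_image.1 (Finset.mem_toRight.1 hm)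
    exact hρf j m hj
  have hA : u.toLeft.card ≤ e.card - 1 := by
    simpa using Finset.card_le_univ u.toLeft
  have hdisj : Disjoint e u.toRight :=
    Finset.disjoint_left.2 fun m hm hm' => (Finset.mem_sdiff.1 (hB hm')).2 hm
  have hf' : (e ∪ u.toRight).card = e.card + u.toRight.card :=
    Finset.card_union_of_disjoint hdisj
  have hpos := hne.card_pos
  have hsub : e ∪ u.toRight ⊆ f :=
    Finset.union_subset hef (hB.trans Finset.sdiff_subset)
  -- The gradients chosen enlarge `e` to the sub-simplex, the tangents chosen are enumerated
  -- increasingly by `σ`. The two dimension bounds say that at most `|e| - 1` tangents and at most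
  -- `k` gradients are chosen.
  let i : M.FormIndex k := ⟨e, e ∪ u.toRight, ⟨hne, T, hT, hef.trans hf⟩,
    ⟨hne.mono Finset.subset_union_left, T, hT, hsub.trans hf⟩, Finset.subset_union_left,
    by omega, by omega, u.toLeft.orderEmbOfFin (by omega)⟩
  refine ⟨i, rfl, hsub, ?_⟩
  change Set.range ρ = Set.range (i.label O)
  ext x
  have hx : x ∈ Set.range ρ ↔ x ∈ u := by simp [hu]
  rw [hx]
  rcases x with a | m
  · refine Iff.trans ?_ (i.inl_mem_range_label O a).symm
    change _ ↔ a ∈ Set.range (u.toLeft.orderEmbOfFin _)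
    simp
  · refine Iff.trans ?_ (i.inr_mem_range_label O m).symm
    change _ ↔ m ∈ (e ∪ u.toRight) \ e
    rw [Finset.union_sdiff_left, Finset.sdiff_eq_self_of_disjoint hdisj.symm, Finset.mem_toRight]

/-- The frame spans the tangent space. -/
theorem tangent_le_of_dofFrame_mem (O : M.Orientation) {T e f : Finset (Fin M.n)}
    (hT : T ∈ M.cells) (hef : e ⊆ f) (hf : f ⊆ T) (hne : e.Nonempty) {S : Submodule ℝ (E d)}
    (hl : ∀ a, dofFrame O T e (Sum.inl a) ∈ S)
    (hr : ∀ m ∈ f \ e, dofFrame O T e (Sum.inr m) ∈ S) : M.tangent f ≤ S := by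
  obtain ⟨m₀, hm₀⟩ := hne
  have hface : M.IsFace e := ⟨⟨m₀, hm₀⟩, T, hT, hef.trans hf⟩
  have hS : M.tangent e ≤ S := by
    rw [← O.span_tan e hface, Submodule.span_le]
    rintro _ ⟨a, rfl⟩
    exact hl a
  refine tangent_le (hef hm₀) fun m hm => ?_
  by_cases hme : m ∈ e
  · exact hS (sub_mem_tangent hme hm₀)
  · exact vert_sub_mem_of_tangent_le hT (Finset.union_subset (hef.trans hf)
      (Finset.singleton_subset_iff.2 (hf hm))) hm₀ hme hS
      (hr m (Finset.mem_sdiff.2 ⟨hm, hme⟩))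

/-- The degree of freedom forms at `e` and the sub-simplices of `f` determine the tangential part
on `f`. -/
theorem apply_eq_zero_of_dofs (O : M.Orientation) {T e f : Finset (Fin M.n)}
    (hT : T ∈ M.cells) (hef : e ⊆ f) (hf : f ⊆ T) (hne : e.Nonempty) {η : Alt d k}
    (h : ∀ i : M.FormIndex k, i.e = e → i.f ⊆ f → altInner η (i.dofForm O T) = 0)
    {v : Fin k → E d} (hv : ∀ j, v j ∈ M.tangent f) : η v = 0 := by
  classical
  -- Gradients at vertices outside `f ∖ e` are replaced by zero: a tuple using one of them is
  -- killed, and every other tuple of distinct labels comes from an index.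
  let b : Fin (e.card - 1) ⊕ Fin M.n → E d :=
    Sum.elim (O.tan e) fun m => if m ∈ f \ e then M.surfGrad T (e ∪ {m}) m else 0
  have hspan : M.tangent f ≤ Submodule.span ℝ (Set.range b) := by
    refine tangent_le_of_dofFrame_mem O hT hef hf hne
      (fun a => Submodule.subset_span ⟨Sum.inl a, rfl⟩)
      (fun m hm => Submodule.subset_span ⟨Sum.inr m, ?_⟩)
    simp only [b, Sum.elim_inr, if_pos hm, dofFrame]
  refine alternating_apply_eq_zero_of_mem_span η b (fun ρ hρ => ?_) v fun j => hspan (hv j)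
  by_cases hρf : ∀ j m, ρ j = Sum.inr m → m ∈ f \ e
  · obtain ⟨i, rfl, hif, hrange⟩ := exists_formIndex_range_label_eq O hT hef hf hne hρ hρf
    refine alternating_apply_eq_zero_of_range_eq η b hρ (i.label_injective O) hrange ?_
    have hi := h i rfl hif
    rw [i.altInner_dofForm] at hi
    rw [← hi]
    congr 1
    funext j
    have hj : i.label O j ∈ Set.range (i.label O) := ⟨j, rfl⟩
    revert hj
    simp only [Function.comp_apply]
    generalize i.label O j = x
    rcases x with a | m
    · exact fun _ => rfl
    · intro hm
      rw [i.inr_mem_range_label, Finset.mem_sdiff] at hm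
      simp only [b, dofFrame, Sum.elim_inr]
      rw [if_pos (Finset.mem_sdiff.2 ⟨hif hm.1, hm.2⟩)]
  · push Not at hρf
    obtain ⟨j, m, hj, hm⟩ := hρf
    exact η.map_coord_zero j (by simp only [Function.comp_apply, hj, b, Sum.elim_inr, if_neg hm])

theorem tangent_cell {T : Finset (Fin M.n)} (hT : T ∈ M.cells) : M.tangent T = ⊤ := by
  have hne : T.Nonempty := Finset.card_pos.1 (by rw [M.card_cell T hT]; omega)
  refine Submodule.eq_top_of_finrank_eq ?_
  rw [finrank_tangent hT subset_rfl hne, M.card_cell T hT]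
  simp

theorem eq_zero_of_dofs (O : M.Orientation) {T e : Finset (Fin M.n)}
    (hT : T ∈ M.cells) (he : e ⊆ T) (hne : e.Nonempty) {η : Alt d k}
    (h : ∀ i : M.FormIndex k, i.e = e → i.f ⊆ T → altInner η (i.dofForm O T) = 0) : η = 0 := by
  ext v
  exact apply_eq_zero_of_dofs O hT he subset_rfl hne h fun j => by
    rw [tangent_cell hT]
    trivial

/-! ### Duality of the two frames -/

/-- Everything follows from `∇λ_m` being normal to sub-simplices without `m`: to `e`, which settles
the mixed pairs, and to `e ∪ {m'}` for `m ≠ m'`, which settles two gradients. The tangents are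
orthonormal. -/
theorem inner_shapeFrame_dofFrame_eq_zero (O : M.Orientation) {T e : Finset (Fin M.n)}
    (hT : T ∈ M.cells) (hne : e.Nonempty) {x y : Fin (e.card - 1) ⊕ Fin M.n}
    (hx : ∀ m, x = Sum.inr m → m ∉ e) (heT : e ⊆ T)
    (hy : ∀ m, y = Sum.inr m → m ∈ T \ e) (hxy : x ≠ y) :
    inner ℝ (shapeFrame O T e x) (dofFrame O T e y) = 0 := by
  have hface : M.IsFace e := ⟨hne, T, hT, heT⟩
  rcases x with a | m <;> rcases y with b | m'
  · exact (O.orthonormal_tan e hface).2 fun h => hxy (h ▸ rfl)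
  · have hm' := Finset.mem_sdiff.1 (hy m' rfl)
    change inner ℝ (O.tan e a) (M.surfGrad T (e ∪ {m'}) m') = 0
    rw [real_inner_comm, inner_surfGrad _ _ _
      (tangent_mono Finset.subset_union_left (tan_mem_tangent O hface a))]
    exact inner_gradBary_eq_zero hT heT hm'.2 (tan_mem_tangent O hface a)
  · exact inner_gradBary_eq_zero hT heT (hx m rfl) (tan_mem_tangent O hface b)
  · have hm' := Finset.mem_sdiff.1 (hy m' rfl)
    refine inner_gradBary_eq_zero hT (f := e ∪ {m'})
      (Finset.union_subset heT (Finset.singleton_subset_iff.2 hm'.1)) ?_ (surfGrad_mem _ _ _)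
    rw [Finset.mem_union, Finset.mem_singleton, not_or]
    exact ⟨hx m rfl, fun h => hxy (h ▸ rfl)⟩

theorem inner_shapeFrame_dofFrame_self_ne_zero (O : M.Orientation) {T e : Finset (Fin M.n)}
    (hT : T ∈ M.cells) (hne : e.Nonempty) (heT : e ⊆ T) {x : Fin (e.card - 1) ⊕ Fin M.n}
    (hx : ∀ m, x = Sum.inr m → m ∈ T \ e) :
    inner ℝ (shapeFrame O T e x) (dofFrame O T e x) ≠ 0 := by
  have hface : M.IsFace e := ⟨hne, T, hT, heT⟩
  rcases x with a | m
  · change inner ℝ (O.tan e a) (O.tan e a) ≠ 0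
    rw [real_inner_self_eq_norm_sq, (O.orthonormal_tan e hface).1 a]
    norm_num
  · have hm := Finset.mem_sdiff.1 (hx m rfl)
    obtain ⟨m₀, hm₀⟩ := hne
    exact inner_surfGrad_self_ne_zero hT (g := e ∪ {m}) (a := m₀)
      (Finset.union_subset heT (Finset.singleton_subset_iff.2 hm.1)) (by simp) (by simp [hm₀])
      fun h => hm.2 (h ▸ hm₀)

/-- By biorthogonality the determinant is that of a diagonal matrix with nonzero entries. -/
theorem altInner_shapeForm_dofForm_self_ne_zero (i : M.FormIndex k) (O : M.Orientation)
    {T : Finset (Fin M.n)} (hT : T ∈ M.cells) (hf : i.f ⊆ T) :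
    altInner (i.shapeForm O T) (i.dofForm O T) ≠ 0 := by
  have heT := i.e_subset.trans hf
  have hmem : ∀ a m, i.label O a = Sum.inr m → m ∈ T \ i.e := by
    intro a m h
    have := (i.inr_mem_range_label O m).1 ⟨a, h⟩
    exact Finset.sdiff_subset_sdiff hf subset_rfl this
  rw [i.altInner_dofForm, i.shapeForm_eq, wedgeFlat_apply]
  have hdiag : (Matrix.of fun a b => inner ℝ ((shapeFrame O T i.e ∘ i.label O) a)
      ((dofFrame O T i.e ∘ i.label O) b)) = Matrix.diagonal fun a =>
        inner ℝ ((shapeFrame O T i.e ∘ i.label O) a) ((dofFrame O T i.e ∘ i.label O) a) := by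
    ext a b
    rw [Matrix.diagonal_apply]
    split_ifs with h
    · subst h
      rfl
    · exact inner_shapeFrame_dofFrame_eq_zero O hT i.isFace_e.1
        (fun m hm => (Finset.mem_sdiff.1 (hmem a m hm)).2) heT (hmem b)
        fun e => h (i.label_injective O e)
  rw [hdiag, Matrix.det_diagonal]
  exact Finset.prod_ne_zero_iff.2 fun a _ =>
    inner_shapeFrame_dofFrame_self_ne_zero O hT i.isFace_e.1 heT (hmem a)

/-- A label of `j` that does not occur in `i` produces a zero row of the determinant. Such a label
exists because, for a given `e`, the set of labels determines `f` and `σ`, and all these sets have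
`k` elements. -/
theorem altInner_shapeForm_dofForm_eq_zero (i j : M.FormIndex k) (O : M.Orientation)
    {T : Finset (Fin M.n)} (hT : T ∈ M.cells) (hf : i.f ⊆ T) (he : j.e = i.e) (hij : j ≠ i) :
    altInner (j.shapeForm O T) (i.dofForm O T) = 0 := by
  classical
  obtain ⟨e, f, h1, h2, h3, h4, h5, σ⟩ := i
  obtain ⟨e', f', h1', h2', h3', h4', h5', σ'⟩ := j
  simp only at he
  subst he
  set i : M.FormIndex k := ⟨e', f, h1, h2, h3, h4, h5, σ⟩ with hi
  set j : M.FormIndex k := ⟨e', f', h1', h2', h3', h4', h5', σ'⟩ with hj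
  have heT := h3.trans hf
  rw [i.altInner_dofForm, j.shapeForm_eq, wedgeFlat_apply]
  have hex : ∃ a, j.label O a ∉ Set.range (i.label O : Fin k → Fin (e'.card - 1) ⊕ Fin M.n) := by
    by_contra! hall
    have hsub : Finset.univ.image (j.label O : Fin k → Fin (e'.card - 1) ⊕ Fin M.n) ⊆
        Finset.univ.image (i.label O) := by
      intro x hx
      obtain ⟨a, -, rfl⟩ := Finset.mem_image.1 hx
      obtain ⟨b, hb⟩ := hall a
      exact Finset.mem_image.2 ⟨b, Finset.mem_univ _, hb⟩
    have heq := Finset.eq_of_subset_of_card_le hsub (by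
      rw [Finset.card_image_of_injective _ (i.label_injective O),
        Finset.card_image_of_injective _ (j.label_injective O)])
    have hrange : Set.range (j.label O) = Set.range (i.label O) := by
      have := congrArg (fun s : Finset (Fin (e'.card - 1) ⊕ Fin M.n) =>
        (s : Set (Fin (e'.card - 1) ⊕ Fin M.n))) heq
      simpa using this
    have hff : f' \ e' = f \ e' := by
      ext m
      have hm : Sum.inr m ∈ Set.range (j.label O) ↔ Sum.inr m ∈ Set.range (i.label O) := by
        rw [hrange]
      exact (j.inr_mem_range_label O m).symm.trans (hm.trans (i.inr_mem_range_label O m))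
    have hff' : f' = f := by
      rw [← Finset.union_sdiff_of_subset h3, ← Finset.union_sdiff_of_subset h3', hff]
    subst hff'
    refine hij ?_
    have hσ : σ' = σ := by
      refine OrderEmbedding.range_inj.1 (Set.ext fun a => ?_)
      have ha : Sum.inl a ∈ Set.range (j.label O) ↔ Sum.inl a ∈ Set.range (i.label O) := by
        rw [hrange]
      exact (j.inl_mem_range_label O a).symm.trans (ha.trans (i.inl_mem_range_label O a))
    rw [hi, hj, hσ]
  obtain ⟨a, ha⟩ := hex
  refine Matrix.det_eq_zero_of_row_eq_zero a fun b => ?_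
  refine inner_shapeFrame_dofFrame_eq_zero O hT h1.1 (fun m hm => ?_) heT (fun m hm => ?_) ?_
  · exact (Finset.mem_sdiff.1 ((j.inr_mem_range_label O m).1 ⟨a, hm⟩)).2
  · exact Finset.sdiff_subset_sdiff hf subset_rfl ((i.inr_mem_range_label O m).1 ⟨b, hm⟩)
  · exact fun h => ha ⟨b, h.symm⟩

end Mesh

/-- Continuous functions on finitely many compact sets with null intersections are the
restrictions of a square integrable function. -/
theorem exists_memLp_of_isCompact {X F ι : Type*} [TopologicalSpace X] [T2Space X]
    [SecondCountableTopology X] [MeasurableSpace X] [BorelSpace X] [NormedAddCommGroup F]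
    (μ : Measure X) [IsFiniteMeasureOnCompacts μ] (s : Finset ι) (K : ι → Set X)
    (hK : ∀ i ∈ s, IsCompact (K i)) (hnull : ∀ i ∈ s, ∀ j ∈ s, i ≠ j → μ (K i ∩ K j) = 0)
    (p : ι → X → F) (hp : ∀ i ∈ s, Continuous (p i)) :
    ∃ g : X → F, MemLp g 2 μ ∧ ∀ i ∈ s, g =ᵐ[μ.restrict (K i)] p i := by
  classical
  have hmeas : ∀ i ∈ s, MeasurableSet (K i) := fun i hi => (hK i hi).measurableSet
  have hLp : ∀ i ∈ s, MemLp ((K i).indicator (p i)) 2 μ := by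
    intro i hi
    rw [memLp_indicator_iff_restrict (hmeas i hi)]
    obtain ⟨C, hC⟩ := (hK i hi).exists_bound_of_continuousOn (hp i hi).continuousOn
    have : IsFiniteMeasure (μ.restrict (K i)) :=
      ⟨by rw [Measure.restrict_apply_univ]; exact (hK i hi).measure_lt_top⟩
    exact MemLp.of_bound (hp i hi).aestronglyMeasurable C
      ((ae_restrict_iff' (hmeas i hi)).2 (Filter.Eventually.of_forall hC))
  -- The sum of the indicators times `p i`: where the sets overlap it has too many terms, but only
  -- on a null set.
  refine ⟨_, memLp_finsetSum' s hLp, fun i hi => ?_⟩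
  have h : ∀ᵐ x ∂(μ.restrict (K i)), ∀ j ∈ s, j ≠ i → x ∉ K j := by
    rw [Filter.eventually_all_finset]
    intro j hj
    by_cases hne : j = i
    · exact Filter.Eventually.of_forall fun x h => absurd hne h
    · have : ∀ᵐ x ∂(μ.restrict (K i)), x ∉ K j := by
        rw [ae_iff, Measure.restrict_apply' (hmeas i hi)]
        simpa using hnull j hj i hi hne
      filter_upwards [this] with x hx _ using hx
  filter_upwards [h, ae_restrict_mem (hmeas i hi)] with x hx hxi
  rw [Finset.sum_apply, Finset.sum_eq_single i]
  · exact Set.indicator_of_mem hxi _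
  · exact fun j hj hne => Set.indicator_of_notMem (hx j hj hne) _
  · exact fun h => absurd hi h

namespace Mesh

variable {d : ℕ} {M : Mesh d} {k : ℕ}

/-! ### Moments determine the tangential parts -/

theorem continuous_polyEval {d : ℕ} (q : MvPolynomial (Fin d) ℝ) : Continuous (polyEval q) :=
  (MvPolynomial.continuous_eval q).comp (continuous_pi fun i => by fun_prop)

/-- A function that is a combination of the interior Lagrange functions of `e` and that is
orthogonal to the polynomials of degree at most `r - (s + 1)` vanishes. -/
theorem lagrange_coeff_eq_zero {T e : Finset (Fin M.n)} (hT : T ∈ M.cells) (he : e ⊆ T)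
    (hne : e.Nonempty) {r : ℕ} (hr : 1 ≤ r) {A : Finset (Fin M.n → ℕ)}
    (hA : ∀ α ∈ A, ∑ m, α m = r ∧ ∀ m, α m ≠ 0 ↔ m ∈ e) (c : (Fin M.n → ℕ) → ℝ)
    {g : E d → ℝ} (hg : ∀ x ∈ M.simplex e, g x = ∑ α ∈ A, M.lagrange r α T x * c α)
    (hmom : ∀ q : MvPolynomial (Fin d) ℝ, q.totalDegree + e.card ≤ r →
      ∫ x in M.simplex e, g x * polyEval q x
        ∂(Measure.euclideanHausdorffMeasure (e.card - 1)) = 0) :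
    ∀ x ∈ M.simplex e, g x = 0 := by
  classical
  have hfac : ∀ α : Fin M.n → ℕ, ∃ q : MvPolynomial (Fin d) ℝ, α ∈ A →
      q.totalDegree + e.card ≤ r ∧
        ∀ x, M.lagrange r α T x = (∏ m ∈ e, M.bary T m x) * polyEval q x := by
    intro α
    by_cases h : α ∈ A
    · obtain ⟨q, hq⟩ := exists_lagrange_eq_bubble_mul (T := T) (hA α h).1 (hA α h).2
      exact ⟨q, fun _ => hq⟩
    · exact ⟨0, fun h' => absurd h' h⟩
  choose q hq using hfac
  set Q : MvPolynomial (Fin d) ℝ := ∑ α ∈ A, MvPolynomial.C (c α) * q α with hQ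
  have hgQ : ∀ x ∈ M.simplex e, g x = (∏ m ∈ e, M.bary T m x) * polyEval Q x := by
    intro x hx
    rw [hg x hx, hQ, polyEval_sum, Finset.mul_sum]
    refine Finset.sum_congr rfl fun α hα => ?_
    rw [(hq α hα).2 x, polyEval_mul, polyEval_C]
    ring
  -- If `r < |e|` nothing may be tested, but then there are no interior lattice points either. A
  -- member of `A` is what guarantees `|e| ≤ r`, so that `Q` is an admissible test polynomial.
  rcases A.eq_empty_or_nonempty with hA0 | ⟨α₀, hα₀⟩
  · intro x hx
    rw [hg x hx, hA0, Finset.sum_empty]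
  have hdeg : Q.totalDegree + e.card ≤ r := by
    have h1 := (hq α₀ hα₀).1
    have h2 : Q.totalDegree ≤ r - e.card :=
      MvPolynomial.totalDegree_finsetSum_le fun α hα => by
        have h3 := (hq α hα).1
        have h4 := totalDegree_C_mul_le (c α) (q α)
        omega
    omega
  -- The moment against `Q` itself, whose integrand is nonnegative on `e`.
  have hint : ∫ x in M.simplex e, (∏ m ∈ e, M.bary T m x) * polyEval Q x ^ 2
      ∂(Measure.euclideanHausdorffMeasure (e.card - 1)) = 0 := by
    rw [← hmom Q hdeg]
    refine setIntegral_congr_fun (isCompact_simplex e).measurableSet fun x hx => ?_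
    rw [hgQ x hx]
    ring
  have hcont : Continuous fun x => (∏ m ∈ e, M.bary T m x) * polyEval Q x ^ 2 :=
    (continuous_finsetProd _ fun m _ => continuous_bary T m).mul ((continuous_polyEval Q).pow 2)
  have hc : ∀ α ∈ A, c α = 0 := by
    intro α hα
    have hmem := mem_piAntidiag_of_support (hA α hα).1 (fun m => ((hA α hα).2 m).1) he
    have hpos : ∀ m ∈ e, 0 < M.bary T m (M.latticePoint r α) := by
      intro m hm
      rw [bary_latticePoint hT hr hmem]
      have := Nat.pos_of_ne_zero (((hA α hα).2 m).2 hm)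
      positivity
    have hzero : ∀ m, m ∉ e → M.bary T m (M.latticePoint r α) = 0 := by
      intro m hm
      have : α m = 0 := by
        by_contra h
        exact hm (((hA α hα).2 m).1 h)
      rw [bary_latticePoint hT hr hmem, this, Nat.cast_zero, zero_div]
    have h0 := eq_zero_of_setIntegral_simplex_eq_zero hT he hne hcont
      (fun y hy => mul_nonneg (Finset.prod_nonneg ((mem_simplex_iff hT he y).1 hy).1)
        (sq_nonneg _)) hint hpos hzero
    have hQ0 : polyEval Q (M.latticePoint r α) = 0 := by
      rcases mul_eq_zero.1 h0 with h | h
      · exact absurd h (Finset.prod_pos hpos).ne'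
      · exact pow_eq_zero_iff two_ne_zero |>.1 h
    have hxe := latticePoint_mem_simplex hT he hr (hA α hα).1 fun m => ((hA α hα).2 m).1
    have h1 := hgQ _ hxe
    rw [hQ0, mul_zero, hg _ hxe, Finset.sum_eq_single α] at h1
    · rwa [lagrange_latticePoint hT hr (hA α hα).1 hmem, if_pos rfl, one_mul] at h1
    · intro β hβ hβα
      rw [lagrange_latticePoint hT hr (hA β hβ).1 hmem, if_neg hβα, zero_mul]
    · exact fun h => absurd hα h
  intro x hx
  rw [hg x hx]
  exact Finset.sum_eq_zero fun α hα => by rw [hc α hα, mul_zero]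

/-- A polynomial form whose moments on the sub-simplices of `f` vanish has no tangential part
on `f`. -/
theorem tangential_eq_zero_of_moments (O : M.Orientation) {T f : Finset (Fin M.n)}
    (hT : T ∈ M.cells) (hf : f ⊆ T) {r : ℕ} (hr : 1 ≤ r) {p : E d → Alt d k}
    (hp : p ∈ polyForms d k r)
    (h : ∀ i : M.FormIndex k, i.f ⊆ f → ∀ q : MvPolynomial (Fin d) ℝ,
      q.totalDegree + i.e.card ≤ r → i.moment O T q p = 0)
    (e : Finset (Fin M.n)) (he : e ⊆ f) {x : E d} (hx : x ∈ M.simplex e) {v : Fin k → E d}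
    (hv : ∀ j, v j ∈ M.tangent f) : p x v = 0 := by
  classical
  -- The claim concerns all vectors tangent to `f`, not just the frame of one `e`: at boundary
  -- points of `e` the induction hypothesis is used with the frame of `e`, not with that of the
  -- smaller sub-simplex.
  induction e using Finset.strongInduction generalizing x v with
  | H e ih =>
    rcases e.eq_empty_or_nonempty with rfl | hne
    · simp [simplex] at hx
    have heT := he.trans hf
    refine apply_eq_zero_of_dofs O hT he hf hne (fun i hie hif => ?_) hv
    subst hie
    have hvi : ∀ j, (dofFrame O T i.e ∘ i.label O) j ∈ M.tangent f := fun j =>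
      tangent_mono hif (i.dofFrame_label_mem O T j)
    refine lagrange_coeff_eq_zero hT heT hne hr
      (A := (T.piAntidiag r).filter fun α => ∀ m, α m ≠ 0 ↔ m ∈ i.e)
      (fun α hα => ⟨sum_eq_of_mem_piAntidiag (Finset.mem_filter.1 hα).1,
        (Finset.mem_filter.1 hα).2⟩)
      (fun α => altInner (p (M.latticePoint r α)) (i.dofForm O T))
      (g := fun y => altInner (p y) (i.dofForm O T)) (fun y hy => ?_) (h i hif) x hx
    have hexp : altInner (p y) (i.dofForm O T) = ∑ α ∈ T.piAntidiag r,
        M.lagrange r α T y * altInner (p (M.latticePoint r α)) (i.dofForm O T) := by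
      simp only [i.altInner_dofForm]
      rw [polyForms_eq_sum_lagrange hT hr hp y]
      simp
    rw [hexp]
    symm
    refine Finset.sum_subset (Finset.filter_subset _ _) fun α hα hαe => ?_
    -- If the support of `α` is a proper subset of `e`, the coefficient vanishes by induction. If it
    -- leaves `e`, the function `φ_α` vanishes on `e`.
    by_cases hsub : ∀ m, α m ≠ 0 → m ∈ i.e
    · have hne' : (Finset.univ.filter fun m => α m ≠ 0) ≠ i.e := by
        intro heq
        refine hαe (Finset.mem_filter.2 ⟨hα, fun m => ?_⟩)
        rw [← heq]
        simp
      have hss : (Finset.univ.filter fun m => α m ≠ 0) ⊆ i.e := fun m hm =>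
        hsub m (Finset.mem_filter.1 hm).2
      have hssub : (Finset.univ.filter fun m => α m ≠ 0) ⊂ i.e :=
        Finset.ssubset_iff_subset_ne.2 ⟨hss, hne'⟩
      rw [i.altInner_dofForm, ih _ hssub (hss.trans he)
        (latticePoint_mem_simplex hT (hss.trans heT) hr (sum_eq_of_mem_piAntidiag hα)
          (fun m hm => Finset.mem_filter.2 ⟨Finset.mem_univ m, hm⟩)) hvi, mul_zero]
    · push Not at hsub
      obtain ⟨m, hm, hme⟩ := hsub
      rw [lagrange_eq_zero hm (((mem_simplex_iff hT heT y).1 hy).2 m hme), zero_mul]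

theorem FormIndex.moment_congr (i : M.FormIndex k) (O : M.Orientation)
    {T T' : Finset (Fin M.n)} (hT : T ∈ M.cells) (hT' : T' ∈ M.cells) (hf : i.f ⊆ T)
    (hf' : i.f ⊆ T') (q : MvPolynomial (Fin d) ℝ) (p : E d → Alt d k) :
    i.moment O T q p = i.moment O T' q p := by
  unfold FormIndex.moment
  rw [i.dofForm_congr O hT hT' hf hf']

/-- The tangential parts of the members of the finite element space are single-valued. -/
theorem altInner_piece_eq {O : M.Orientation} {r : ℕ} (hr : 1 ≤ r) {ω : M.L2Forms k}
    (hω : ω ∈ M.feSpace O k r) (i : M.FormIndex k) {T T' : Finset (Fin M.n)} (hT : T ∈ M.cells)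
    (hT' : T' ∈ M.cells) (hf : i.f ⊆ T) (hf' : i.f ⊆ T') {x : E d} (hx : x ∈ M.simplex i.e) :
    altInner (M.piece r ω T x) (i.dofForm O T) =
      altInner (M.piece r ω T' x) (i.dofForm O T') := by
  rcases le_or_gt i.f.card d with hd | hd
  · have hp := (isPiece_piece hω hT).1
    have hp' := (isPiece_piece hω hT').1
    -- Pieces are polynomial on all of `ℝ^d`, so the piece of `T'` may be subtracted from that of
    -- `T` and the difference treated as a form on `T`.
    have hneg : (-1 : ℝ) • M.piece r ω T' ∈ polyForms d k r := Submodule.smul_mem _ _ hp'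
    have h0 := tangential_eq_zero_of_moments O hT hf hr (Submodule.add_mem _ hp hneg)
      (fun j hj q hq => by
        rw [j.moment_add O T q hp hneg, j.moment_smul,
          moment_piece_eq hr hω j ((Finset.card_le_card hj).trans hd) hT hT' (hj.trans hf)
            (hj.trans hf') q hq, j.moment_congr O hT hT' (hj.trans hf) (hj.trans hf')]
        ring) i.e i.e_subset hx (i.dofFrame_label_mem O T)
    rw [← i.dofForm_congr O hT hT' hf hf', i.altInner_dofForm, i.altInner_dofForm]
    have h1 : M.piece r ω T x (dofFrame O T i.e ∘ i.label O) +
        (-1 : ℝ) * M.piece r ω T' x (dofFrame O T i.e ∘ i.label O) = 0 := h0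
    linarith
  -- With `d + 1` vertices `f` is itself a cell, so `T = T'` and no condition on moments is needed.
  · have h1 : i.f = T := Finset.eq_of_subset_of_card_le hf (by rw [M.card_cell T hT]; omega)
    have h2 : i.f = T' := Finset.eq_of_subset_of_card_le hf' (by rw [M.card_cell T' hT']; omega)
    rw [← h1, ← h2]

/-! ### Forms with given pieces -/

/-- By conformity the intersection is spanned by the common vertices. A vertex `m` of `T` not in
`T'` exists, and `λ_m` vanishes on their affine hull, which is therefore proper. -/
theorem measure_simplex_inter_eq_zero {T T' : Finset (Fin M.n)} (hT : T ∈ M.cells)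
    (hT' : T' ∈ M.cells) (hne : T ≠ T') : volume (M.simplex T ∩ M.simplex T') = 0 := by
  have hss : ∃ m ∈ T, m ∉ T' := by
    by_contra! hc
    exact hne (Finset.eq_of_subset_of_card_le hc
      (by rw [M.card_cell T hT, M.card_cell T' hT']))
  obtain ⟨m, hm, hm'⟩ := hss
  have hinter : M.simplex T ∩ M.simplex T' = M.simplex (T ∩ T') := M.conforming T hT T' hT'
  rw [hinter]
  let H : AffineSubspace ℝ (E d) := affineSpan ℝ (M.vert '' ((T ∩ T' : Finset _) : Set (Fin M.n)))
  have hH : H ≠ ⊤ := by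
    intro htop
    have hle : ∀ x ∈ H, M.bary T m x = 0 := by
      intro x hx
      have : H ≤ (AffineSubspace.mk' (0 : ℝ) (⊥ : Submodule ℝ ℝ)).comap (M.bary T m) := by
        refine affineSpan_le.2 ?_
        rintro _ ⟨a, ha, rfl⟩
        have ha' := Finset.mem_inter.1 (Finset.mem_coe.1 ha)
        have : M.bary T m (M.vert a) = 0 := by
          rw [bary_vert hT m ha'.1, if_neg]
          rintro rfl
          exact hm' ha'.2
        simp [this]
      simpa using this hx
    have h1 := hle (M.vert m) (by rw [htop]; trivial)
    rw [bary_vert hT m hm, if_pos rfl] at h1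
    exact one_ne_zero h1
  exact measure_mono_null (convexHull_subset_affineSpan _)
    (Measure.addHaar_affineSubspace volume H hH)

/-- Polynomial forms on the simplices are the pieces of a form in `L²`. -/
theorem exists_L2Forms_isPiece {r : ℕ} (p : Finset (Fin M.n) → E d → Alt d k)
    (hp : ∀ T ∈ M.cells, p T ∈ polyForms d k r) :
    ∃ ω : M.L2Forms k, ∀ T ∈ M.cells, M.IsPiece r ω T (p T) := by
  obtain ⟨g, hg, hgp⟩ := exists_memLp_of_isCompact (volume : Measure (E d)) M.cells M.simplex
    (fun T _ => isCompact_simplex T)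
    (fun T hT T' hT' hne => measure_simplex_inter_eq_zero hT hT' hne) p
    fun T hT => continuous_of_mem_polyForms (hp T hT)
  have hg' := hg.restrict M.domain
  refine ⟨hg'.toLp g, fun T hT => ⟨hp T hT, ?_⟩⟩
  have h1 : hg'.toLp g =ᵐ[volume.restrict (M.simplex T)] g :=
    ae_mono (Measure.restrict_mono (simplex_subset_domain hT) le_rfl) hg'.coeFn_toLp
  exact h1.trans (hgp T hT)

end Mesh

namespace Mesh

variable {d : ℕ} {M : Mesh d} {k r : ℕ}

/-! ### The basis -/

instance finite_formIndex : Finite (M.FormIndex k) := by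
  refine Finite.of_injective (β := Σ (e : Finset (Fin M.n)) (f : Finset (Fin M.n)),
    (Fin (e.card + k - f.card) ↪o Fin (e.card - 1))) (fun i => ⟨i.e, i.f, i.σ⟩) ?_
  rintro ⟨e, f, _, _, _, _, _, σ⟩ ⟨e', f', _, _, _, _, _, σ'⟩ h
  simp only [Sigma.mk.injEq] at h
  obtain ⟨rfl, h⟩ := h
  simp only [heq_eq_eq, Sigma.mk.injEq] at h
  obtain ⟨rfl, h⟩ := h
  simp only [heq_eq_eq] at h
  rw [h]

theorem DofIndex.ext_of_eq {i j : M.DofIndex k r} (h : i.toFormIndex = j.toFormIndex)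
    (hα : i.α = j.α) : i = j := by
  cases i
  cases j
  simp only at h hα
  subst h
  subst hα
  rfl

instance finite_dofIndex : Finite (M.DofIndex k r) := by
  refine Finite.of_injective (β := M.FormIndex k ×
    ((Finset.univ : Finset (Fin M.n)).piAntidiag r : Set (Fin M.n → ℕ)))
    (fun i => ⟨i.toFormIndex, i.α, mem_piAntidiag_of_support i.sum_α
      (fun m _ => Finset.mem_univ m) subset_rfl⟩) fun i j h => ?_
  simp only [Prod.mk.injEq, Subtype.mk.injEq] at h
  exact DofIndex.ext_of_eq h.1 h.2

theorem lagrange_congr {T T' f : Finset (Fin M.n)} (hT : T ∈ M.cells) (hT' : T' ∈ M.cells)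
    (hf : f ⊆ T) (hf' : f ⊆ T') (α : Fin M.n → ℕ) {x : E d} (hx : x ∈ M.simplex f) :
    M.lagrange r α T x = M.lagrange r α T' x := by
  simp only [lagrange, bary_eq_of_mem_simplex hT hT' hf hf' hx]

/-- The tangential parts of `d♭t^e_σ ∧ dλ_{[f∖e]}` are single-valued. -/
theorem FormIndex.shapeForm_apply_congr (i : M.FormIndex k) (O : M.Orientation)
    {T T' f : Finset (Fin M.n)} (hT : T ∈ M.cells) (hT' : T' ∈ M.cells)
    (hf : f ⊆ T) (hf' : f ⊆ T') {v : Fin k → E d} (hv : ∀ a, v a ∈ M.tangent f) :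
    i.shapeForm O T v = i.shapeForm O T' v := by
  rw [i.shapeForm_eq, i.shapeForm_eq, wedgeFlat_apply, wedgeFlat_apply]
  congr 1
  ext a b
  simp only [Matrix.of_apply, Function.comp_apply]
  rcases i.label O a with c | m
  · rfl
  · exact inner_gradBary_congr hT hT' hf hf' m (hv b)

theorem DofIndex.altInner_shape (i : M.DofIndex k r) (O : M.Orientation)
    (T : Finset (Fin M.n)) (x : E d) (η : Alt d k) :
    altInner (i.shape O T x) η = M.lagrange r i.α T x * altInner (i.shapeForm O T) η := by
  simp [DofIndex.shape, altInner, Finset.mul_sum, mul_assoc]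

theorem DofIndex.shape_mem_polyForms (i : M.DofIndex k r) (O : M.Orientation)
    (T : Finset (Fin M.n)) : i.shape O T ∈ polyForms d k r :=
  lagrange_smul_mem_polyForms i.sum_α T (i.shapeForm O T)

/-- The integrands of the moments agree pointwise on `e`: the Lagrange functions have the same
trace, and the exterior factor is evaluated only at vectors tangent to `f`. -/
theorem DofIndex.exists_mem_feSpace (i : M.DofIndex k r) (O : M.Orientation) :
    ∃ ω : M.feSpace O k r, ∀ T ∈ M.cells, M.IsPiece r (ω : M.L2Forms k) T (i.shape O T) := by
  obtain ⟨ω, hω⟩ := exists_L2Forms_isPiece (i.shape O) fun T _ => i.shape_mem_polyForms O T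
  refine ⟨⟨ω, i.shape O, hω, fun j _ T hT T' hT' hf hf' q _ => ?_⟩, hω⟩
  unfold FormIndex.moment
  refine setIntegral_congr_fun (isCompact_simplex j.e).measurableSet fun x hx => ?_
  have heT := j.e_subset.trans hf
  have heT' := j.e_subset.trans hf'
  have h1 : altInner (i.shapeForm O T) (j.dofForm O T) =
      altInner (i.shapeForm O T') (j.dofForm O T') := by
    rw [← j.dofForm_congr O hT hT' hf hf', j.altInner_dofForm, j.altInner_dofForm]
    exact i.shapeForm_apply_congr O hT hT' hf hf' (j.dofFrame_label_mem O T)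
  simp only [i.altInner_shape, h1, lagrange_congr hT hT' heT heT' i.α hx]

theorem DofIndex.latticePoint_mem (i : M.DofIndex k r) (hr : 1 ≤ r) :
    M.latticePoint r i.α ∈ M.simplex i.e := by
  obtain ⟨-, T, hT, hf⟩ := i.isFace_e
  exact latticePoint_mem_simplex hT hf hr i.sum_α fun m => (i.support_α m).1

theorem DofIndex.nodal_congr (i : M.DofIndex k r) {O : M.Orientation} (hr : 1 ≤ r)
    {ω : M.L2Forms k} (hω : ω ∈ M.feSpace O k r) {T T' : Finset (Fin M.n)} (hT : T ∈ M.cells)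
    (hT' : T' ∈ M.cells) (hf : i.f ⊆ T) (hf' : i.f ⊆ T') :
    i.nodal O T ω = i.nodal O T' ω :=
  altInner_piece_eq hr hω i.toFormIndex hT hT' hf hf' (i.latticePoint_mem hr)

/-- The nodal degree of freedom computed from `T` as a linear functional. -/
def DofIndex.nodalLinear (i : M.DofIndex k r) (O : M.Orientation) (hr : 1 ≤ r)
    {T : Finset (Fin M.n)} (hT : T ∈ M.cells) : M.feSpace O k r →ₗ[ℝ] ℝ where
  toFun ω := i.nodal O T ω
  map_add' ω ω' := by
    have h : M.piece r ((ω + ω' : M.feSpace O k r) : M.L2Forms k) T =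
        M.piece r (ω : M.L2Forms k) T + M.piece r (ω' : M.L2Forms k) T :=
      ((isPiece_piece ω.2 hT).add hT (isPiece_piece ω'.2 hT)).piece_eq hr hT
    unfold DofIndex.nodal
    rw [h, i.altInner_dofForm, i.altInner_dofForm, i.altInner_dofForm]
    rfl
  map_smul' c ω := by
    have h : M.piece r ((c • ω : M.feSpace O k r) : M.L2Forms k) T =
        c • M.piece r (ω : M.L2Forms k) T :=
      ((isPiece_piece ω.2 hT).smul hT c).piece_eq hr hT
    unfold DofIndex.nodal
    rw [h, i.altInner_dofForm, i.altInner_dofForm]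
    rfl

/-- The degrees of freedom determine the members of the finite element space. -/
theorem eq_of_nodal_eq {O : M.Orientation} (hr : 1 ≤ r) {ω ω' : M.L2Forms k}
    (hω : ω ∈ M.feSpace O k r) (hω' : ω' ∈ M.feSpace O k r)
    (h : ∀ i : M.DofIndex k r, ∀ T ∈ M.cells, i.f ⊆ T → i.nodal O T ω = i.nodal O T ω') :
    ω = ω' := by
  classical
  refine eq_of_ae_eq_on_cells fun T hT => ?_
  have hp := isPiece_piece hω hT
  have hp' := isPiece_piece hω' hT
  have heq : M.piece r ω T = M.piece r ω' T := by
    refine polyForms_eq_of_latticePoint hT hr hp.1 hp'.1 fun α hα => sub_eq_zero.1 ?_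
    have hsum := sum_eq_of_mem_piAntidiag hα
    have hsupp := (Finset.mem_piAntidiag.1 hα).2
    have hne : (Finset.univ.filter fun m => α m ≠ 0).Nonempty := by
      by_contra hemp
      rw [Finset.not_nonempty_iff_eq_empty, Finset.filter_eq_empty_iff] at hemp
      have : ∑ m, α m = 0 := Finset.sum_eq_zero fun m hm => not_not.1 (hemp hm)
      omega
    -- Each lattice point of `T` is interior to exactly one sub-simplex, the support of `α`; its
    -- degrees of freedom determine the value of the form there.
    refine eq_zero_of_dofs O hT (e := Finset.univ.filter fun m => α m ≠ 0)
      (fun m hm => hsupp m (Finset.mem_filter.1 hm).2) hne fun i hie hif => ?_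
    rw [altInner_sub_left, sub_eq_zero]
    exact h ⟨i, α, hsum, fun m => by rw [hie]; simp⟩ T hT hif
  exact hp.2.trans (heq ▸ hp'.2.symm)

/-- The forms `φ_α d♭t^e_σ ∧ dλ_{[f∖e]}` are dual to the degrees of freedom up to scaling. -/
theorem DofIndex.altInner_shape_dofForm (i j : M.DofIndex k r) (O : M.Orientation) (hr : 1 ≤ r)
    {T : Finset (Fin M.n)} (hT : T ∈ M.cells) (hf : i.f ⊆ T) :
    altInner (i.shape O T (M.latticePoint r i.α)) (i.dofForm O T) ≠ 0 ∧
      (j ≠ i → altInner (j.shape O T (M.latticePoint r i.α)) (i.dofForm O T) = 0) := by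
  have hmem := mem_piAntidiag_of_support i.sum_α (fun m => (i.support_α m).1)
    (i.e_subset.trans hf)
  refine ⟨?_, fun hji => ?_⟩
  · rw [i.altInner_shape, lagrange_latticePoint hT hr i.sum_α hmem, if_pos rfl, one_mul]
    exact altInner_shapeForm_dofForm_self_ne_zero i.toFormIndex O hT hf
  · rw [j.altInner_shape, lagrange_latticePoint hT hr j.sum_α hmem]
    -- Equal multi-indices have the same support `e`, so the exterior factors decide; for different
    -- ones the scalar factor vanishes.
    split_ifs with hα
    · have he : j.e = i.e := by
        ext m
        rw [← i.support_α, ← j.support_α, hα]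
      rw [altInner_shapeForm_dofForm_eq_zero i.toFormIndex j.toFormIndex O hT hf he
        fun h => hji (DofIndex.ext_of_eq h hα), mul_zero]
    · rw [zero_mul]

end Mesh

end TNForms

end

/-! ### Assembly: a dual family and separating functionals -/

theorem theorem5p4 {d : ℕ} (hd : 2 ≤ d) (M : TNForms.Mesh d) (O : M.Orientation)
    (k r : ℕ) (hk : k ≤ d) (hr : 1 ≤ r) :
    -- the nodal degrees of freedom are single-valued across `f`
    (∀ ω ∈ M.feSpace O k r, ∀ i : M.DofIndex k r, ∀ T ∈ M.cells, ∀ T' ∈ M.cells,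
      i.f ⊆ T → i.f ⊆ T' → i.nodal O T ω = i.nodal O T' ω) ∧
    -- unisolvence
    (∀ c : M.DofIndex k r → ℝ, ∃! ω : M.L2Forms k, ω ∈ M.feSpace O k r ∧
      ∀ i : M.DofIndex k r, ∀ T ∈ M.cells, i.f ⊆ T → i.nodal O T ω = c i) ∧
    -- the Lagrange-type functions are a basis of the space, scaled dual to the degrees of freedom
    (∃ φ : Module.Basis (M.DofIndex k r) ℝ (M.feSpace O k r),
      (∀ i : M.DofIndex k r, ∀ T ∈ M.cells,
        ((φ i : M.L2Forms k) : TNForms.E d → TNForms.Alt d k)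
          =ᵐ[MeasureTheory.volume.restrict (M.simplex T)] i.shape O T) ∧
      ∀ i j : M.DofIndex k r, ∀ T ∈ M.cells, i.f ⊆ T →
        i.nodal O T (φ i) ≠ 0 ∧ (j ≠ i → i.nodal O T (φ j) = 0)) := by
  classical
  have : Fintype (M.DofIndex k r) := Fintype.ofFinite _
  -- One cell is fixed for each index to obtain a linear functional `N i`; by single-valuedness
  -- (`hN`) the choice is immaterial.
  choose cell hcell hfcell using fun i : M.DofIndex k r => i.isFace_f.2
  choose b hb using fun i : M.DofIndex k r => i.exists_mem_feSpace O
  let N : (i : M.DofIndex k r) → M.feSpace O k r →ₗ[ℝ] ℝ := fun i =>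
    i.nodalLinear O hr (hcell i)
  have hN : ∀ (i : M.DofIndex k r) (ω : M.feSpace O k r), ∀ T ∈ M.cells, i.f ⊆ T →
      i.nodal O T ω = N i ω := fun i ω T hT hf =>
    i.nodal_congr hr ω.2 hT (hcell i) hf (hfcell i)
  have hNb : ∀ i j : M.DofIndex k r,
      N i (b j) = TNForms.altInner (j.shape O (cell i) (M.latticePoint r i.α))
        (i.dofForm O (cell i)) := by
    intro i j
    change TNForms.altInner (M.piece r _ _ _) _ = _
    rw [(hb j (cell i) (hcell i)).piece_eq hr (hcell i)]
  have hdual : ∀ i j : M.DofIndex k r, N i (b i) ≠ 0 ∧ (j ≠ i → N i (b j) = 0) := by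
    intro i j
    rw [hNb, hNb]
    exact i.altInner_shape_dofForm j O hr (hcell i) (hfcell i)
  have hcomb : ∀ (c : M.DofIndex k r → ℝ) (i : M.DofIndex k r),
      N i (∑ j, c j • b j) = c i * N i (b i) := by
    intro c i
    rw [map_sum, Finset.sum_eq_single i]
    · rw [map_smul, smul_eq_mul]
    · intro j _ hj
      rw [map_smul, (hdual i j).2 hj, smul_zero]
    · exact fun h => absurd (Finset.mem_univ i) h
  have hext : ∀ ω ω' : M.feSpace O k r, (∀ i, N i ω = N i ω') → ω = ω' := by
    intro ω ω' h
    refine Subtype.ext (TNForms.Mesh.eq_of_nodal_eq hr ω.2 ω'.2 fun i T hT hf => ?_)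
    rw [hN i ω T hT hf, hN i ω' T hT hf, h i]
  refine ⟨fun ω hω i T hT T' hT' hf hf' => i.nodal_congr hr hω hT hT' hf hf', fun c => ?_, ?_⟩
  -- The system is diagonal, so prescribed values are met after division by the scaling factors.
  · refine ⟨(∑ i, (c i / N i (b i)) • b i : M.feSpace O k r), ⟨Subtype.property _,
      fun i T hT hf => ?_⟩, ?_⟩
    · rw [hN i _ T hT hf, hcomb, div_mul_cancel₀ _ (hdual i i).1]
    · rintro ω ⟨hω, hωc⟩
      refine TNForms.Mesh.eq_of_nodal_eq hr hω (Subtype.property _) fun i T hT hf => ?_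
      rw [hωc i T hT hf, hN i _ T hT hf, hcomb, div_mul_cancel₀ _ (hdual i i).1]
  · have hli : LinearIndependent ℝ b := by
      refine Fintype.linearIndependent_iff.2 fun g hg i => ?_
      have h := hcomb g i
      rw [hg, map_zero] at h
      exact (mul_eq_zero.1 h.symm).resolve_right (hdual i i).1
    have hspan : ⊤ ≤ Submodule.span ℝ (Set.range b) := by
      intro ω _
      have : ω = ∑ i, (N i ω / N i (b i)) • b i := hext _ _ fun i => by
        rw [hcomb, div_mul_cancel₀ _ (hdual i i).1]
      rw [this]
      exact Submodule.sum_mem _ fun i _ => Submodule.smul_mem _ _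
        (Submodule.subset_span ⟨i, rfl⟩)
    refine ⟨Module.Basis.mk hli hspan, fun i T hT => ?_, fun i j T hT hf => ?_⟩
    · rw [Module.Basis.mk_apply]
      exact (hb i T hT).2
    · rw [Module.Basis.mk_apply, Module.Basis.mk_apply, hN i _ T hT hf, hN i _ T hT hf]
      exact hdual i j
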